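/- Let $S,A$ be Polish spaces, $P$ a Markov kernel from $S\times A$ to $S$, $c:S\times A\to\mathbb R$ bounded and measurable, $\mu$ a probability measure on $A$, and $0<\tau<1$. A policy is a Markov kernel $\pi(da|s)$ from $S$ to $A$. For $\gamma\in(0,1)$ put $$V^\pi_\tau(s)=\mathbb E^\pi_s\Big[\sum_{n\ge 0}\gamma^n\big(c(s_n,a_n)+\tau\,\mathrm{KL}(\pi(\cdot|s_n)|\mu)\big)\Big]\in\mathbb R\cup\{\infty\},\qquad V^\pi_\tau(\rho)=\int_S V^\pi_\tau(s)\,\rho(ds),$$ $$Q^\pi_\tau(s,a)=c(s,a)+\gamma\int_S V^\pi_\tau(s')P(ds'|s,a).$$ Let $P_\pi(ds'|s)=\int_A P(ds'|s,a)\pi(da|s)$ and $P^\pi(ds',da'|s,a)=P(ds'|s,a)\pi(da'|s')$, and define the occupancy measures $d^\pi_\rho=(1-\gamma)\sum_{n\ge0}\gamma^n\rho P_\pi^n$ for probability measures $\rho$ on $S$ and $d^\pi_\beta=(1-\gamma)\sum_{n\ge0}\gamma^n\beta (P^\pi)^n$ for probability measures $\beta$ on $S\times A$. Let $\Pi_\mu$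 be the set of policies of the form $\pi(da|s)=e^{f(s,a)}\mu(da)/\int_A e^{f(s,a')}\mu(da')$ with $f$ bounded and measurable. For measurable $\phi:S\times A\to\mathbb R^N$ put $Q(s,a;\theta)=\langle\theta,\phi(s,a)\rangle$, let $$T^\pi f(s,a)=c(s,a)+\gamma\int f\,dP^\pi(\cdot|s,a)+\tau\gamma\int_S\mathrm{KL}(\pi(\cdot|s')|\mu)P(ds'|s,a),$$ $$g(\theta,\pi)=\int_{S\times A}\big(Q(s,a;\theta)-T^\pi Q(s,a;\theta)\big)\phi(s,a)\,d^\pi_\beta(ds,da).$$ For a non-decreasing $\eta:[0,\infty)\to[1,\infty)$, the coupled actor–critic flow started at $\theta_0\in\mathbb R^N$, $\pi_0\in\Pi_\mu$ is $$\frac{d\theta_t}{dt}=-\eta_t\,g(\theta_t,\pi_t),\qquad \partial_t\pi_t(da|s)=-A_t(s,a)\,\pi_t(da|s)\qquad(t\ge0),$$ where $A_t(s,a)=Q(s,a;\theta_t)+\tau\ln\frac{d\pi_t}{d\mu}(s,a)-\int_A\big(Q(s,a';\theta_t)+\tau\ln\frac{d\pi_t}{d\mu}(s,a')\big)\pi_t(da'|s)$;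 the second equation is understood for densities, at all $(s,a)$, with $\ln\frac{d\pi_t}{d\mu}$ bounded and measurable for each $t$. Assume $|\phi(s,a)|\le1$ for all $(s,a)$, and let $\beta$ be a probability measure on $S\times A$ such that $\lambda_\beta:=\lambda_{\min}\big(\int\phi\phi^\top d\beta\big)>0$. Put $\Gamma=\lambda_\beta(1-\gamma)(1-\sqrt\gamma)$. Let $\rho$ be a probability measure on $S$, $\theta_0\in\mathbb R^N$, $\pi_0\in\Pi_\mu$ and $\eta_0\in\mathbb R$. Theorem. There are $k_1>0$ and $k_2>0$ such that the following holds for every $\gamma\in(0,1)$ for which $\eta_0>1/\Gamma$ and for which every $\pi\in\Pi_\mu$ admits $\theta_\pi\in\mathbb R^N$ with $Q^\pi_\tau(s,a)=\langle\theta_\pi,\phi(s,a)\rangle$ for all $(s,a)$. Let $(\pi_t,\theta_t)_{t\ge0}$ be a trajectory of the coupled actor–critic flow with $\eta_t=\eta_0e^{k_1t}$ started at $(\pi_0,\theta_0)$, and let $\pi^*$ be an optimal policy, i.e. $V^{\pi^*}_\tau(\rho)\le V^\pi_\tau(\rho)$ for all policies $\pi$. Then $\int_S\mathrm{KL}(\pi^*(\cdot|s)|\pi_0(\cdot|s))\,d^{\pi^*}_\rho(ds)<\infty$,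 and for every $t>0$ the minimum below is attained, it and $V^{\pi^*}_\tau(\rho)$ are finite, and $$\min_{r\in[0,t]}V^{\pi_r}_\tau(\rho)-V^{\pi^*}_\tau(\rho)\le\frac{\tau e^{-\frac\tau2t}}{2(1-\gamma)\big(1-e^{-\frac\tau2t}\big)}\left(\int_S\mathrm{KL}(\pi^*(\cdot|s)|\pi_0(\cdot|s))\,d^{\pi^*}_\rho(ds)+\frac{k_2}{2\tau}\right).$$ -/

import Mathlib

open MeasureTheory ProbabilityTheory

namespace ActorCritic

/-- `f ∈ B_b(E)`: a bounded measurable real function. -/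
def IsBddMeasurable {E : Type*} [MeasurableSpace E] (f : E → ℝ) : Prop :=
  Measurable f ∧ ∃ C : ℝ, ∀ x, |f x| ≤ C

/-- The data of a Markov decision process, apart from the discount factor: the transition
kernel `P`, the bounded cost `c` and the reference probability measure `μ` on actions. -/
structure MDP (S A : Type*) [MeasurableSpace S] [MeasurableSpace A] where
  P : Kernel (S × A) S
  isMarkov_P : IsMarkovKernel P
  c : S × A → ℝ
  isBdd_c : IsBddMeasurable c
  μ : Measure A
  isProb_μ : IsProbabilityMeasure μ

attribute [instance] MDP.isMarkov_P MDP.isProb_μ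

/-- A stochastic policy `π ∈ 𝒫(A | S)`. -/
structure Policy (S A : Type*) [MeasurableSpace S] [MeasurableSpace A] where
  kernel : Kernel S A
  isMarkov : IsMarkovKernel kernel

attribute [instance] Policy.isMarkov

noncomputable section

variable {S A : Type*} [MeasurableSpace S] [MeasurableSpace A]

/-- The class `Π_μ`: `π(da|s) = exp f(s,a) / (∫ exp f(s,a') μ(da')) μ(da)` with `f ∈ B_b(S × A)`. -/
def Policy.Admissible (μ : Measure A) (π : Policy S A) : Prop :=
  ∃ f : S × A → ℝ, IsBddMeasurable f ∧ ∀ s, π.kernel s = μ.tilted (fun a => f (s, a))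

/-- `u ∈ B_b(S × A)` is the logarithmic density `ln (dπ/dμ)`. -/
def IsLogDensity (μ : Measure A) (π : Policy S A) (u : S × A → ℝ) : Prop :=
  IsBddMeasurable u ∧
    ∀ s, π.kernel s = μ.withDensity (fun a => ENNReal.ofReal (Real.exp (u (s, a))))

/-! ### The controlled Markov chain, occupancy measures -/

/-- `P_π(ds'|s) = ∫ P(ds'|s,a) π(da|s)`. -/
def stateKernel (M : MDP S A) (π : Policy S A) : Kernel S S :=
  M.P ∘ₖ (Kernel.id ×ₖ π.kernel)

/-- `P^π(ds',da'|s,a) = P(ds'|s,a) π(da'|s')`. -/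
def stateActionKernel (M : MDP S A) (π : Policy S A) : Kernel (S × A) (S × A) :=
  M.P ⊗ₖ Kernel.prodMkLeft (S × A) π.kernel

instance (M : MDP S A) (π : Policy S A) : IsMarkovKernel (stateKernel M π) := by
  unfold stateKernel; infer_instance

instance (M : MDP S A) (π : Policy S A) : IsMarkovKernel (stateActionKernel M π) := by
  unfold stateActionKernel; infer_instance

/-- The law `ℙ_s^π` of the trajectory `(s₀,a₀), (s₁,a₁), …` with `s₀ = s`,
`aₙ ~ π(·|sₙ)` and `sₙ₊₁ ~ P(·|sₙ,aₙ)`. -/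
def pathLaw (M : MDP S A) (π : Policy S A) (s : S) : Measure (ℕ → S × A) :=
  Kernel.trajMeasure (X := fun _ => S × A) ((Kernel.id ×ₖ π.kernel) s)
    (fun n => (stateActionKernel M π).comap
      (fun h : (Π _ : Finset.Iic n, S × A) => h ⟨n, Finset.mem_Iic.2 le_rfl⟩)
      (measurable_pi_apply _))

/-- The occupancy kernel `(1-γ) ∑ₙ γⁿ κⁿ(dy|x)` of a kernel `κ`. -/
def occupancy {X : Type*} [MeasurableSpace X] (γ : ℝ) (κ : Kernel X X) : Kernel X X where
  toFun x := Measure.sum fun n : ℕ => ENNReal.ofReal ((1 - γ) * γ ^ n) • (κ ^ n) x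
  measurable' := by
    refine Measure.measurable_of_measurable_coe _ fun B hB => ?_
    simp only [Measure.sum_apply _ hB, Measure.smul_apply, smul_eq_mul]
    exact Measurable.tsum fun n => ((κ ^ n).measurable_coe hB).const_mul _

/-- `d^π_ρ`, the state occupancy measure. -/
def stateOccupancy (M : MDP S A) (γ : ℝ) (π : Policy S A) (ρ : Measure S) : Measure S :=
  ρ.bind (occupancy γ (stateKernel M π))

/-- `d^π_β`, the state-action occupancy measure. -/
def stateActionOccupancy (M : MDP S A) (γ : ℝ) (π : Policy S A) (β : Measure (S × A)) :
    Measure (S × A) :=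
  β.bind (occupancy γ (stateActionKernel M π))

/-! ### Value functions -/

/-- `KL(π(·|s) | μ) ∈ [0,∞]`. -/
def klRef (M : MDP S A) (π : Policy S A) (s : S) : ENNReal :=
  InformationTheory.klDiv (π.kernel s) M.μ

/-- `𝔼_s^π [∑ₙ γⁿ c(sₙ,aₙ)]`. -/
def costValue (M : MDP S A) (γ : ℝ) (π : Policy S A) (s : S) : ℝ :=
  ∫ ω, ∑' n : ℕ, γ ^ n * M.c (ω n) ∂(pathLaw M π s)

/-- `𝔼_s^π [∑ₙ γⁿ τ KL(π(·|sₙ) | μ)] ∈ [0,∞]`. -/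
def entropyValue (M : MDP S A) (γ τ : ℝ) (π : Policy S A) (s : S) : ENNReal :=
  ∫⁻ ω, ∑' n : ℕ, ENNReal.ofReal (γ ^ n * τ) * klRef M π (ω n).1 ∂(pathLaw M π s)

/-- `V^π_τ(s) ∈ ℝ ∪ {∞}`: the expectation of a bounded term plus a `[0,∞]`-valued term. -/
def value (M : MDP S A) (γ τ : ℝ) (π : Policy S A) (s : S) : EReal :=
  (costValue M γ π s : EReal) + (entropyValue M γ τ π s : EReal)

/-- `V^π_τ(ρ) = ∫ V^π_τ(s) ρ(ds) ∈ ℝ ∪ {∞}`: again the integral of a bounded term plus a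
`[0,∞]`-valued term. -/
def valueAt (M : MDP S A) (γ τ : ℝ) (π : Policy S A) (ρ : Measure S) : EReal :=
  ((∫ s, costValue M γ π s ∂ρ : ℝ) : EReal) + ((∫⁻ s, entropyValue M γ τ π s ∂ρ : ENNReal) : EReal)

/-- `π` attains the minimum of `V^·_τ(ρ)` over all stochastic policies. -/
def IsOptimal (M : MDP S A) (γ τ : ℝ) (ρ : Measure S) (π : Policy S A) : Prop :=
  ∀ π' : Policy S A, valueAt M γ τ π ρ ≤ valueAt M γ τ π' ρ

/-- `Q^π_τ(s,a) = c(s,a) + γ ∫ V^π_τ(s') P(ds'|s,a)`. It is used for `π ∈ Π_μ` only, for which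
`V^π_τ` is real and bounded. -/
def qFun (M : MDP S A) (γ τ : ℝ) (π : Policy S A) (x : S × A) : ℝ :=
  M.c x + γ * ∫ s', (value M γ τ π s').toReal ∂(M.P x)

/-- The Bellman operator `T^π`, used for `π ∈ Π_μ` only. -/
def bellman (M : MDP S A) (γ τ : ℝ) (π : Policy S A) (f : S × A → ℝ) (x : S × A) : ℝ :=
  M.c x + γ * ∫ y, f y ∂(stateActionKernel M π x)
    + τ * γ * ∫ s', (klRef M π s').toReal ∂(M.P x)

/-! ### Linear function approximation -/

variable {N : ℕ}

/-- `Q(s,a;θ) = ⟨θ, φ(s,a)⟩`. -/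
def qLin (φ : S × A → EuclideanSpace ℝ (Fin N)) (θ : EuclideanSpace ℝ (Fin N)) (x : S × A) : ℝ :=
  inner ℝ θ (φ x)

/-- `Q^π_τ`-realisability: for every `π ∈ Π_μ` there is `θ_π` with `Q^π_τ = ⟨θ_π, φ⟩`. -/
def Realisable (M : MDP S A) (γ τ : ℝ) (φ : S × A → EuclideanSpace ℝ (Fin N)) : Prop :=
  ∀ π : Policy S A, π.Admissible M.μ →
    ∃ θ : EuclideanSpace ℝ (Fin N), ∀ x, qFun M γ τ π x = qLin φ θ x

/-- The minimal eigenvalue of a symmetric real matrix. -/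
def lambdaMin (B : Matrix (Fin N) (Fin N) ℝ) : ℝ := sInf (spectrum ℝ B)

/-- `λ_β = λ_min (∫ φ φᵀ dβ)`. -/
def lambdaBeta (φ : S × A → EuclideanSpace ℝ (Fin N)) (β : Measure (S × A)) : ℝ :=
  lambdaMin (Matrix.of fun i j : Fin N => ∫ x, φ x i * φ x j ∂β)

/-- `Γ = λ_β (1 - γ) (1 - √γ)`. -/
def bigGamma (γ : ℝ) (φ : S × A → EuclideanSpace ℝ (Fin N)) (β : Measure (S × A)) : ℝ :=
  lambdaBeta φ β * (1 - γ) * (1 - Real.sqrt γ)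

/-- The semi-gradient `g(θ,π) = ∫ (Q(·;θ) - T^π Q(·;θ)) φ dd^π_β` of the mean squared Bellman
error. -/
def semiGrad (M : MDP S A) (γ τ : ℝ) (φ : S × A → EuclideanSpace ℝ (Fin N)) (β : Measure (S × A))
    (θ : EuclideanSpace ℝ (Fin N)) (π : Policy S A) : EuclideanSpace ℝ (Fin N) :=
  ∫ x, (qLin φ θ x - bellman M γ τ π (qLin φ θ) x) • φ x ∂(stateActionOccupancy M γ π β)

/-- The approximate soft advantage `A(s,a;θ)` of the policy `π` with `u = ln (dπ/dμ)`. -/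
def approxAdvantage (τ : ℝ) (φ : S × A → EuclideanSpace ℝ (Fin N))
    (θ : EuclideanSpace ℝ (Fin N)) (π : Policy S A) (u : S × A → ℝ) (s : S) (a : A) : ℝ :=
  qLin φ θ (s, a) + τ * u (s, a) - ∫ a', (qLin φ θ (s, a') + τ * u (s, a')) ∂(π.kernel s)

/-- `(π_t, θ_t)_{t ≥ 0}` is a trajectory of the coupled actor-critic flow with timescale
separation `η`, started at `(π₀, θ₀)`:
`dθ_t/dt = -η_t g(θ_t, π_t)` and `∂_t π_t(da|s) = -A(s,a;θ_t) π_t(da|s)`.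
The second equation is an equation for the densities `dπ_t/dμ = exp (u_t)`, for all `(s,a)`.
Derivatives at `t = 0` are one-sided; the values at `t < 0` play no role. -/
def IsFlow (M : MDP S A) (γ τ : ℝ) (φ : S × A → EuclideanSpace ℝ (Fin N)) (β : Measure (S × A))
    (η : ℝ → ℝ) (π₀ : Policy S A) (θ₀ : EuclideanSpace ℝ (Fin N))
    (π : ℝ → Policy S A) (θ : ℝ → EuclideanSpace ℝ (Fin N)) : Prop :=
  π 0 = π₀ ∧ θ 0 = θ₀ ∧
  (∀ t, 0 ≤ t →
    HasDerivWithinAt θ (-(η t • semiGrad M γ τ φ β (θ t) (π t))) (Set.Ici 0) t) ∧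
  ∃ u : ℝ → S × A → ℝ,
    (∀ t, 0 ≤ t → IsLogDensity M.μ (π t) (u t)) ∧
    ∀ t, 0 ≤ t → ∀ s a,
      HasDerivWithinAt (fun r => Real.exp (u r (s, a)))
        (-approxAdvantage τ φ (θ t) (π t) (u t) s a * Real.exp (u t (s, a))) (Set.Ici 0) t

end

end ActorCritic

/-!
The proof follows the relative entropy `J_t = ∫ KL(π*(·|s) | π_t(·|s)) d^{π*}_ρ(ds)` along the
flow.

*Actor.* Since `∂_t ln π_t = -A_t`, the derivative of `J_t` is the mean of `A_t` under the joint
law of the occupancy measure of `π*` and `π*`. For the exact advantage, the performance difference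
identity (`performance_difference`) evaluates this mean as `(1 - γ) (V^{π*} - V^{π_t}) - τ J_t`.
Replacing the exact `Q^{π_t}_τ` by the critic costs `∫ (Q(·; θ_t) - Q^{π_t}_τ) d(π* - π_t)`, and a
weak Pinsker inequality (`integral_sub_le_klDiv_add`) bounds it by
`τ / 2 · J_t + ‖θ_t - θ_{π_t}‖² / τ` (`integral_approxAdvantage_le`). Integrating with the weight `e^{τt/2}` gives
`FlowHyp.gap_le`.

*Critic.* It remains to see that `‖θ_t - θ_{π_t}‖ = O(e^{-τt/2})`, uniformly in the admissible
`γ`. The operator `I - γ P^π` is coercive in the `L²` space of the occupancy measure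
(`coercive_occupancy`), so the semi-gradient contracts towards `θ_{π_t}` at rate `η_t Γ`. On the
other side, the oscillation of the log-density of `π_t` solves a damped linear equation driven by
`θ_t`; this bounds the entropy by the past of the critic, and coercivity bounds the critic by the
entropy. Closing the loop, both grow at most like `e^{ct}` with a rate `c` that does not depend on
how fast `η` grows (`FlowHyp.norm_θ_le`). Hence the target `θ_{π_t}` moves with speed `O(e^{2ct})`
(`FlowHyp.norm_target_sub_le`), and the time scale `η_t = η₀ e^{(2c+1)t}` beats it
(`FlowHyp.critic_error_le`). The constants are uniform in `γ` because `η₀ > 1 / Γ` forces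
`1 / (1 - γ) ≤ η₀ λ_β`.

Values are handled through occupancy measures: the marginals of the path law are powers of the
state kernel followed by the policy (`pathLaw_map`), and the balance equations of the occupancy
kernel (`occupancy_eq_first_step`, `bind_occupancy_eq`) play the role of the Bellman equation.
-/

namespace ActorCritic

/-! ### Marginals of the controlled chain -/

theorem kernel_one_eq_id {X : Type*} [MeasurableSpace X] : (1 : Kernel X X) = Kernel.id := rfl

theorem kernel_mul_eq_comp {X : Type*} [MeasurableSpace X] (κ η : Kernel X X) :
    κ * η = κ ∘ₖ η := rfl

section Chain

variable {S A : Type*} [MeasurableSpace S] [MeasurableSpace A]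

theorem stateActionKernel_eq_comp (M : MDP S A) (π : Policy S A) :
    stateActionKernel M π = (Kernel.id ×ₖ π.kernel) ∘ₖ M.P := by
  refine Kernel.ext_fun fun x f hf => ?_
  rw [stateActionKernel, Kernel.lintegral_compProd _ _ _ hf, Kernel.lintegral_comp _ _ _ hf]
  refine lintegral_congr fun s => ?_
  rw [Kernel.lintegral_id_prod hf]
  rfl

/-- Choosing an action and then running the state-action chain is the same as running the state
chain and choosing an action at the end. -/
theorem stateActionKernel_pow_comp (M : MDP S A) (π : Policy S A) (n : ℕ) :
    (stateActionKernel M π ^ n) ∘ₖ (Kernel.id ×ₖ π.kernel)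
      = (Kernel.id ×ₖ π.kernel) ∘ₖ (stateKernel M π ^ n) := by
  induction n with
  | zero => simp only [pow_zero, kernel_one_eq_id, Kernel.id_comp, Kernel.comp_id]
  | succ n ih =>
    rw [pow_succ', pow_succ', kernel_mul_eq_comp, kernel_mul_eq_comp, Kernel.comp_assoc, ih]
    nth_rewrite 1 [stateActionKernel_eq_comp]
    simp only [stateKernel, Kernel.comp_assoc]

/-- The law of `(sₙ, aₙ)` under `ℙ_s^π`: the state chain run for `n` steps, followed by `π`. -/
theorem pathLaw_map (M : MDP S A) (π : Policy S A) (s : S) (n : ℕ) :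
    (pathLaw M π s).map (fun ω => ω n)
      = ((Kernel.id ×ₖ π.kernel) ∘ₖ (stateKernel M π ^ n)) s := by
  rw [← stateActionKernel_pow_comp]
  induction n with
  | zero =>
    have h : (fun ω : ℕ → S × A => ω 0)
        = (MeasurableEquiv.piUnique (fun _ : Finset.Iic 0 => S × A)) ∘ Preorder.frestrictLe 0 := rfl
    rw [h, ← Measure.map_map (by fun_prop) (by fun_prop), pathLaw, Kernel.trajMeasure,
      Measure.map_comp _ _ (by fun_prop), Kernel.traj_map_frestrictLe, Kernel.partialTraj_self,
      Measure.id_comp, Measure.map_map (by fun_prop) (by fun_prop)]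
    simp only [pow_zero, kernel_one_eq_id, Kernel.id_comp]
    exact Measure.map_id
  | succ n ih =>
    set κ := stateActionKernel M π with hκ
    have h := Kernel.map_frestrictLe_trajMeasure_compProd_eq_map_trajMeasure
      (X := fun _ => S × A) (μ₀ := (Kernel.id ×ₖ π.kernel) s)
      (κ := fun n => κ.comap
        (fun h : (Π _ : Finset.Iic n, S × A) => h ⟨n, Finset.mem_Iic.2 le_rfl⟩)
        (measurable_pi_apply _)) (a := n)
    have h2 := congrArg (Measure.map Prod.snd) h
    rw [Measure.map_map measurable_snd (by fun_prop)] at h2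
    change (pathLaw M π s).map (fun ω => ω (n + 1)) = _
    refine h2.symm.trans ?_
    rw [← Measure.snd, Measure.snd_compProd]
    have h3 : ((Kernel.trajMeasure (X := fun _ => S × A) ((Kernel.id ×ₖ π.kernel) s)
      (fun n => κ.comap
        (fun h : (Π _ : Finset.Iic n, S × A) => h ⟨n, Finset.mem_Iic.2 le_rfl⟩)
        (measurable_pi_apply _))).map (Preorder.frestrictLe n)).map
        (fun h : (Π _ : Finset.Iic n, S × A) => h ⟨n, Finset.mem_Iic.2 le_rfl⟩)
        = ((κ ^ n) ∘ₖ (Kernel.id ×ₖ π.kernel)) s := by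
      rw [Measure.map_map (by fun_prop) (by fun_prop)]
      exact ih
    rw [pow_succ', kernel_mul_eq_comp, Kernel.comp_assoc, Kernel.comp_apply, ← h3]
    ext B hB
    rw [Measure.bind_apply hB (Kernel.aemeasurable _),
      Measure.bind_apply hB (Kernel.aemeasurable _),
      lintegral_map (Kernel.measurable_coe _ hB) (by fun_prop),
      lintegral_map (Kernel.measurable_coe _ hB) (by fun_prop)]
    exact (lintegral_map (f := fun h : (Π _ : Finset.Iic n, S × A) =>
      κ (h ⟨n, Finset.mem_Iic.2 le_rfl⟩) B)
      ((Kernel.measurable_coe κ hB).comp (measurable_pi_apply _)) (by fun_prop)).symm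

end Chain

/-! ### Occupancy kernels -/

section Occupancy

variable {X : Type*} [MeasurableSpace X]

theorem lintegral_occupancy (γ : ℝ) (κ : Kernel X X) (x : X) (f : X → ENNReal) :
    ∫⁻ y, f y ∂(occupancy γ κ x)
      = ∑' n : ℕ, ENNReal.ofReal ((1 - γ) * γ ^ n) * ∫⁻ y, f y ∂((κ ^ n) x) := by
  change ∫⁻ y, f y ∂(Measure.sum fun n : ℕ => ENNReal.ofReal ((1 - γ) * γ ^ n) • (κ ^ n) x) = _
  simp [lintegral_sum_measure, lintegral_smul_measure]

theorem tsum_ofReal_geometric {γ : ℝ} (h0 : 0 ≤ γ) (h1 : γ < 1) :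
    ∑' n : ℕ, ENNReal.ofReal ((1 - γ) * γ ^ n) = 1 := by
  rw [← ENNReal.ofReal_tsum_of_nonneg (fun n => mul_nonneg (by linarith) (pow_nonneg h0 n))
    ((summable_geometric_of_lt_one h0 h1).mul_left _), tsum_mul_left,
    tsum_geometric_of_lt_one h0 h1, mul_inv_cancel₀ (by linarith), ENNReal.ofReal_one]

instance isMarkovKernel_pow (κ : Kernel X X) [IsMarkovKernel κ] (n : ℕ) :
    IsMarkovKernel (κ ^ n) := by
  induction n with
  | zero => rw [pow_zero, kernel_one_eq_id]; infer_instance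
  | succ n ih => rw [pow_succ, kernel_mul_eq_comp]; infer_instance

theorem isMarkovKernel_occupancy {γ : ℝ} (h0 : 0 ≤ γ) (h1 : γ < 1) (κ : Kernel X X)
    [IsMarkovKernel κ] : IsMarkovKernel (occupancy γ κ) := by
  refine ⟨fun x => ⟨?_⟩⟩
  rw [← lintegral_one, lintegral_occupancy]
  simp [tsum_ofReal_geometric h0 h1]

theorem lintegral_occupancy_succ {γ : ℝ} (h0 : 0 ≤ γ) (κ : Kernel X X)
    (f : X → ENNReal) (x : X) :
    ∫⁻ y, f y ∂(occupancy γ κ x) = ENNReal.ofReal (1 - γ) * ∫⁻ y, f y ∂(Measure.dirac x)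
      + ENNReal.ofReal γ *
        ∑' n : ℕ, ENNReal.ofReal ((1 - γ) * γ ^ n) * ∫⁻ y, f y ∂((κ ^ (n + 1)) x) := by
  rw [lintegral_occupancy, tsum_eq_zero_add' ENNReal.summable, ← ENNReal.tsum_mul_left]
  congr 1
  · simp [kernel_one_eq_id, Kernel.id_apply]
  · refine tsum_congr fun n => ?_
    rw [← mul_assoc, ← ENNReal.ofReal_mul h0]
    congr 2
    ring

/-- Conditioning the occupancy measure on the first step of the chain. -/
theorem occupancy_eq_first_step {γ : ℝ} (h0 : 0 ≤ γ) (κ : Kernel X X) (x : X) :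
    occupancy γ κ x = ENNReal.ofReal (1 - γ) • Measure.dirac x
      + ENNReal.ofReal γ • (κ x).bind (occupancy γ κ) := by
  refine Measure.ext_of_lintegral _ fun f hf => ?_
  rw [lintegral_occupancy_succ h0, lintegral_add_measure, lintegral_smul_measure,
    lintegral_smul_measure, Measure.lintegral_bind (Kernel.aemeasurable _) hf.aemeasurable]
  simp only [lintegral_occupancy, smul_eq_mul]
  rw [lintegral_tsum fun n => (hf.lintegral_kernel.const_mul _).aemeasurable]
  congr 2
  refine tsum_congr fun n => ?_
  rw [lintegral_const_mul _ hf.lintegral_kernel, pow_succ, kernel_mul_eq_comp,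
    Kernel.lintegral_comp _ _ _ hf]

/-- The occupancy measure solves the discounted balance equation `d = (1 - γ) m + γ d κ`. -/
theorem bind_occupancy_eq {γ : ℝ} (h0 : 0 ≤ γ) (κ : Kernel X X) (m : Measure X) :
    m.bind (occupancy γ κ) = ENNReal.ofReal (1 - γ) • m
      + ENNReal.ofReal γ • (m.bind (occupancy γ κ)).bind κ := by
  refine Measure.ext_of_lintegral _ fun f hf => ?_
  rw [lintegral_add_measure, lintegral_smul_measure, lintegral_smul_measure,
    Measure.lintegral_bind (Kernel.aemeasurable _) hf.aemeasurable,
    Measure.lintegral_bind (Kernel.aemeasurable _) hf.aemeasurable,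
    Measure.lintegral_bind (Kernel.aemeasurable _) hf.lintegral_kernel.aemeasurable]
  simp only [smul_eq_mul]
  have h : ∀ x, ∫⁻ y, f y ∂(occupancy γ κ x) = ENNReal.ofReal (1 - γ) * f x
      + ENNReal.ofReal γ * ∫⁻ y, ∫⁻ z, f z ∂(κ y) ∂(occupancy γ κ x) := by
    intro x
    rw [lintegral_occupancy_succ h0, lintegral_dirac' _ hf, lintegral_occupancy]
    congr 2
    refine tsum_congr fun n => ?_
    rw [pow_succ', kernel_mul_eq_comp, Kernel.lintegral_comp _ _ _ hf]
  simp only [h]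
  rw [lintegral_add_left (hf.const_mul _), lintegral_const_mul _ hf,
    lintegral_const_mul _ hf.lintegral_kernel.lintegral_kernel]

end Occupancy

/-! ### Bounded measurable functions -/

section Bounded

variable {X Y : Type*} [MeasurableSpace X] [MeasurableSpace Y]

theorem IsBddMeasurable.integrable {f : X → ℝ} (hf : IsBddMeasurable f) (m : Measure X)
    [IsFiniteMeasure m] : Integrable f m := by
  obtain ⟨hm, C, hC⟩ := hf
  exact Integrable.of_bound hm.aestronglyMeasurable C (ae_of_all _ hC)

theorem IsBddMeasurable.add {f g : X → ℝ} (hf : IsBddMeasurable f) (hg : IsBddMeasurable g) :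
    IsBddMeasurable fun x => f x + g x := by
  obtain ⟨hm, C, hC⟩ := hf
  obtain ⟨hm', D, hD⟩ := hg
  exact ⟨hm.add hm', C + D, fun x => (abs_add_le _ _).trans (add_le_add (hC x) (hD x))⟩

theorem IsBddMeasurable.const_mul {f : X → ℝ} (hf : IsBddMeasurable f) (r : ℝ) :
    IsBddMeasurable fun x => r * f x := by
  obtain ⟨hm, C, hC⟩ := hf
  refine ⟨hm.const_mul r, |r| * C, fun x => ?_⟩
  rw [abs_mul]
  exact mul_le_mul_of_nonneg_left (hC x) (abs_nonneg r)

theorem IsBddMeasurable.sub {f g : X → ℝ} (hf : IsBddMeasurable f) (hg : IsBddMeasurable g) :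
    IsBddMeasurable fun x => f x - g x := by
  simpa [sub_eq_add_neg] using hf.add (hg.const_mul (-1))

theorem IsBddMeasurable.mul {f g : X → ℝ} (hf : IsBddMeasurable f) (hg : IsBddMeasurable g) :
    IsBddMeasurable fun x => f x * g x := by
  obtain ⟨hm, C, hC⟩ := hf
  obtain ⟨hm', D, hD⟩ := hg
  refine ⟨hm.mul hm', C * D, fun x => ?_⟩
  rw [abs_mul]
  exact mul_le_mul (hC x) (hD x) (abs_nonneg _) ((abs_nonneg _).trans (hC x))

theorem IsBddMeasurable.comp {f : X → ℝ} (hf : IsBddMeasurable f) {g : Y → X}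
    (hg : Measurable g) : IsBddMeasurable fun y => f (g y) :=
  ⟨hf.1.comp hg, hf.2.imp fun _ h y => h (g y)⟩

theorem abs_integral_le_of_ae {m : Measure X} [IsProbabilityMeasure m] {f : X → ℝ} {C : ℝ}
    (h : ∀ᵐ x ∂m, |f x| ≤ C) : |∫ x, f x ∂m| ≤ C := by
  simpa using norm_integral_le_of_norm_le_const (μ := m) (f := f) (C := C) h

theorem IsBddMeasurable.integral_prod {f : X × Y → ℝ} (hf : IsBddMeasurable f) (κ : Kernel X Y)
    [IsMarkovKernel κ] : IsBddMeasurable fun x => ∫ y, f (x, y) ∂(κ x) := by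
  obtain ⟨hm, C, hC⟩ := hf
  exact ⟨(hm.stronglyMeasurable.integral_kernel_prod_right' (κ := κ)).measurable, C, fun x =>
    abs_integral_le_of_ae (ae_of_all _ fun y => hC _)⟩

theorem IsBddMeasurable.integral_kernel {f : Y → ℝ} (hf : IsBddMeasurable f) (κ : Kernel X Y)
    [IsMarkovKernel κ] : IsBddMeasurable fun x => ∫ y, f y ∂(κ x) :=
  (hf.comp measurable_snd).integral_prod κ

theorem IsBddMeasurable.integral_bind {f : Y → ℝ} (hf : IsBddMeasurable f) (m : Measure X)
    [IsProbabilityMeasure m] (κ : Kernel X Y) [IsMarkovKernel κ] :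
    ∫ y, f y ∂(m.bind κ) = ∫ x, ∫ y, f y ∂(κ x) ∂m := by
  have h := Kernel.integral_comp (κ := Kernel.const Unit m) (η := κ) (a := ()) (f := f)
    (hf.integrable _)
  simpa [Kernel.comp_apply] using h

theorem IsBddMeasurable.integral_id_prod {f : X × Y → ℝ} (hf : IsBddMeasurable f) (κ : Kernel X Y)
    [IsMarkovKernel κ] (x : X) :
    ∫ z, f z ∂((Kernel.id ×ₖ κ) x) = ∫ y, f (x, y) ∂(κ x) := by
  rw [Kernel.prod_apply, Kernel.id_apply, Measure.dirac_prod,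
    integral_map measurable_prodMk_left.aemeasurable hf.1.aestronglyMeasurable]

end Bounded

/-! ### Gibbs measures and relative entropy -/

section Gibbs

open InformationTheory

variable {X : Type*} [MeasurableSpace X] {μ ν κ : Measure X} {u v f : X → ℝ}

/-- A Gibbs density is normalised. -/
theorem integral_exp_eq_one [IsProbabilityMeasure ν] (hu : IsBddMeasurable u)
    (hν : ν = μ.withDensity fun x => ENNReal.ofReal (Real.exp (u x))) :
    ∫ x, Real.exp (u x) ∂μ = 1 := by
  have h : ν Set.univ = 1 := measure_univ
  rw [hν, withDensity_apply _ MeasurableSet.univ, Measure.restrict_univ] at h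
  rw [integral_eq_lintegral_of_nonneg_ae (ae_of_all _ fun x => (Real.exp_pos _).le)
    hu.1.exp.aestronglyMeasurable, h, ENNReal.toReal_one]

theorem IsBddMeasurable.exp (hu : IsBddMeasurable u) : IsBddMeasurable fun x => Real.exp (u x) := by
  obtain ⟨hm, C, hC⟩ := hu
  refine ⟨hm.exp, Real.exp C, fun x => ?_⟩
  rw [abs_of_pos (Real.exp_pos _)]
  exact Real.exp_le_exp.2 ((le_abs_self _).trans (hC x))

theorem withDensity_exp_eq_tilted [IsProbabilityMeasure ν] (hu : IsBddMeasurable u)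
    (hν : ν = μ.withDensity fun x => ENNReal.ofReal (Real.exp (u x))) : ν = μ.tilted u := by
  rw [Measure.tilted, integral_exp_eq_one hu hν]
  simpa using hν

theorem integral_gibbs (hu : IsBddMeasurable u)
    (hν : ν = μ.withDensity fun x => ENNReal.ofReal (Real.exp (u x))) (f : X → ℝ) :
    ∫ x, f x ∂ν = ∫ x, Real.exp (u x) * f x ∂μ := by
  rw [hν, integral_withDensity_eq_integral_toReal_smul hu.1.exp.ennreal_ofReal
    (ae_of_all _ fun _ => ENNReal.ofReal_lt_top)]
  refine integral_congr_ae (ae_of_all _ fun x => ?_)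
  simp [ENNReal.toReal_ofReal (Real.exp_pos _).le]

theorem klDiv_gibbs_ref [IsProbabilityMeasure μ] [IsProbabilityMeasure ν] (hu : IsBddMeasurable u)
    (hν : ν = μ.withDensity fun x => ENNReal.ofReal (Real.exp (u x))) :
    klDiv ν μ = ENNReal.ofReal (∫ x, u x ∂ν) := by
  have hac : ν ≪ μ := by rw [hν]; exact withDensity_absolutelyContinuous _ _
  have hl : llr ν μ =ᵐ[ν] u := by
    have h := log_rnDeriv_tilted_left_self (μ := μ) (hu.exp.integrable μ)
    rw [← withDensity_exp_eq_tilted hu hν, integral_exp_eq_one hu hν] at h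
    filter_upwards [hac.ae_le h] with x hx
    simpa [llr] using hx
  rw [klDiv_of_ac_of_integrable hac ((integrable_congr hl).2 (hu.integrable ν)),
    integral_congr_ae hl]
  simp

/-- Changing the reference measure from `μ` to a Gibbs measure `ν = e^u μ` shifts the relative
entropy by `∫ u`. -/
theorem klDiv_gibbs_right [IsProbabilityMeasure μ] [IsProbabilityMeasure ν]
    [IsProbabilityMeasure κ] (hu : IsBddMeasurable u)
    (hν : ν = μ.withDensity fun x => ENNReal.ofReal (Real.exp (u x))) (hκ : klDiv κ μ ≠ ⊤) :
    klDiv κ ν ≠ ⊤ ∧ (klDiv κ ν).toReal = (klDiv κ μ).toReal - ∫ x, u x ∂κ := by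
  obtain ⟨hac, hint⟩ := klDiv_ne_top_iff.1 hκ
  have he := hu.exp.integrable μ
  have ht := withDensity_exp_eq_tilted hu hν
  have hac' : κ ≪ ν := by
    rw [ht]; exact hac.trans (absolutelyContinuous_tilted he)
  have hint' : Integrable (llr κ ν) κ := by
    rw [ht]; exact integrable_llr_tilted_right hac (hu.integrable κ) hint he
  refine ⟨klDiv_ne_top hac' hint', ?_⟩
  rw [toReal_klDiv_of_measure_eq hac' (by simp), toReal_klDiv_of_measure_eq hac (by simp)]
  rw [ht, integral_llr_tilted_right hac (hu.integrable κ) he hint, integral_exp_eq_one hu hν]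
  simp

/-- A weak form of Pinsker's inequality: the Donsker–Varadhan bound combined with Hoeffding's
lemma for the moment generating function of `f`. -/
theorem integral_sub_le_klDiv_add [IsProbabilityMeasure ν] [IsProbabilityMeasure κ]
    (hf : Measurable f) {H : ℝ} (hH : ∀ x, |f x| ≤ H) (hκ : klDiv κ ν ≠ ⊤) :
    ∫ x, f x ∂κ - ∫ x, f x ∂ν ≤ (klDiv κ ν).toReal + H ^ 2 / 2 := by
  have hfb : IsBddMeasurable f := ⟨hf, H, hH⟩
  obtain ⟨hac, hint⟩ := klDiv_ne_top_iff.1 hκ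
  have he := hfb.exp.integrable ν
  have : IsProbabilityMeasure (ν.tilted f) := isProbabilityMeasure_tilted he
  have hac' : κ ≪ ν.tilted f := hac.trans (absolutelyContinuous_tilted he)
  have h1 : 0 ≤ ∫ x, llr κ (ν.tilted f) x ∂κ := by
    rw [← toReal_klDiv_of_measure_eq hac' (by simp)]; exact ENNReal.toReal_nonneg
  rw [integral_llr_tilted_right hac (hfb.integrable κ) he hint,
    ← toReal_klDiv_of_measure_eq hac (by simp)] at h1
  have hsub := (hasSubgaussianMGF_of_mem_Icc (μ := ν) (a := -H) (b := H) hf.aemeasurable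
    (ae_of_all _ fun x => abs_le.1 (hH x))).mgf_le 1
  have h2 : mgf (fun x => f x - ∫ y, f y ∂ν) ν 1
      = Real.exp (-∫ y, f y ∂ν) * ∫ x, Real.exp (f x) ∂ν := by
    simp only [mgf, one_mul]
    rw [← integral_const_mul]
    refine integral_congr_ae (ae_of_all _ fun x => ?_)
    simp only [← Real.exp_add]
    ring_nf
  have hpos : 0 < ∫ x, Real.exp (f x) ∂ν := integral_exp_pos he
  have h3 : Real.log (∫ x, Real.exp (f x) ∂ν) ≤ ∫ y, f y ∂ν + H ^ 2 / 2 := by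
    rw [Real.log_le_iff_le_exp hpos, Real.exp_add]
    rw [h2] at hsub
    have h4 : Real.exp (∫ y, f y ∂ν) * (Real.exp (-∫ y, f y ∂ν) * ∫ x, Real.exp (f x) ∂ν)
        = ∫ x, Real.exp (f x) ∂ν := by
      rw [← mul_assoc, ← Real.exp_add]; simp
    rw [← h4]
    refine mul_le_mul_of_nonneg_left (hsub.trans (Real.exp_le_exp.2 (le_of_eq ?_)))
      (Real.exp_pos _).le
    have h5 : ((‖H - -H‖₊ / 2 : NNReal) : ℝ) ^ 2 = H ^ 2 := by
      push_cast
      rw [div_pow, Real.norm_eq_abs, sq_abs]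
      ring
    push_cast at h5 ⊢
    rw [h5]; ring
  linarith

theorem abs_exp_sub_exp_le (x y : ℝ) :
    |Real.exp x - Real.exp y| ≤ |x - y| * (Real.exp x + Real.exp y) := by
  wlog h : y ≤ x generalizing x y
  · rw [abs_sub_comm, abs_sub_comm x, add_comm]
    exact this y x (le_of_not_ge h)
  rw [abs_of_nonneg (sub_nonneg.2 (Real.exp_le_exp.2 h)), abs_of_nonneg (sub_nonneg.2 h)]
  have h1 : Real.exp y = Real.exp x * Real.exp (y - x) := by rw [← Real.exp_add]; ring_nf
  have h2 := Real.add_one_le_exp (y - x)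
  have h3 := mul_le_mul_of_nonneg_left h2 (Real.exp_pos x).le
  have h4 := mul_nonneg (sub_nonneg.2 h) (Real.exp_pos y).le
  nlinarith

/-- Gibbs measures with uniformly close logarithmic densities are close in total variation. -/
theorem abs_integral_gibbs_sub_le {ν' : Measure X} [IsProbabilityMeasure μ]
    [IsProbabilityMeasure ν] [IsProbabilityMeasure ν']
    (hu : IsBddMeasurable u) (hv : IsBddMeasurable v)
    (hν : ν = μ.withDensity fun x => ENNReal.ofReal (Real.exp (u x)))
    (hν' : ν' = μ.withDensity fun x => ENNReal.ofReal (Real.exp (v x)))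
    {δ : ℝ} (hδ : ∀ᵐ x ∂μ, |u x - v x| ≤ δ) (hf : IsBddMeasurable f) {C : ℝ}
    (hC : ∀ᵐ x ∂μ, |f x| ≤ C) :
    |∫ x, f x ∂ν - ∫ x, f x ∂ν'| ≤ 2 * C * δ := by
  rw [integral_gibbs hu hν, integral_gibbs hv hν', ← integral_sub
    ((hu.exp.mul hf).integrable μ) ((hv.exp.mul hf).integrable μ)]
  have hb : ∀ᵐ x ∂μ, ‖Real.exp (u x) * f x - Real.exp (v x) * f x‖
      ≤ C * δ * (Real.exp (u x) + Real.exp (v x)) := by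
    filter_upwards [hδ, hC] with x hx hx'
    rw [← sub_mul, Real.norm_eq_abs, abs_mul]
    have h1 := abs_exp_sub_exp_le (u x) (v x)
    have h2 : 0 ≤ Real.exp (u x) + Real.exp (v x) := by positivity
    have h0 := mul_le_mul_of_nonneg_right hx h2
    calc |Real.exp (u x) - Real.exp (v x)| * |f x|
        ≤ (δ * (Real.exp (u x) + Real.exp (v x))) * C :=
          mul_le_mul (h1.trans h0) hx' (abs_nonneg _)
            ((abs_nonneg _).trans (h1.trans h0))
      _ = _ := by ring
  have hi : Integrable (fun x => C * δ * (Real.exp (u x) + Real.exp (v x))) μ :=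
    ((hu.exp.add hv.exp).const_mul _).integrable μ
  refine (norm_integral_le_of_norm_le hi hb).trans (le_of_eq ?_)
  rw [integral_const_mul, integral_add (hu.exp.integrable μ) (hv.exp.integrable μ),
    integral_exp_eq_one hu hν, integral_exp_eq_one hv hν']
  ring

theorem gibbs_ae_of_ae (hν : ν = μ.withDensity fun x => ENNReal.ofReal (Real.exp (u x)))
    {p : X → Prop} (h : ∀ᵐ x ∂μ, p x) : ∀ᵐ x ∂ν, p x := by
  rw [hν]
  exact (withDensity_absolutelyContinuous _ _).ae_le h

theorem abs_entropy_gibbs_sub_le {ν' : Measure X} [IsProbabilityMeasure μ]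
    [IsProbabilityMeasure ν] [IsProbabilityMeasure ν']
    (hu : IsBddMeasurable u) (hv : IsBddMeasurable v)
    (hν : ν = μ.withDensity fun x => ENNReal.ofReal (Real.exp (u x)))
    (hν' : ν' = μ.withDensity fun x => ENNReal.ofReal (Real.exp (v x)))
    {δ W : ℝ} (hδ : ∀ᵐ x ∂μ, |u x - v x| ≤ δ) (hW : ∀ᵐ x ∂μ, |v x| ≤ W) :
    |∫ x, u x ∂ν - ∫ x, v x ∂ν'| ≤ (1 + 2 * W) * δ := by
  have h1 := abs_integral_gibbs_sub_le hu hv hν hν' hδ hv hW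
  have h2 : |∫ x, (u x - v x) ∂ν| ≤ δ := abs_integral_le_of_ae (gibbs_ae_of_ae hν hδ)
  rw [integral_sub (hu.integrable ν) (hv.integrable ν)] at h2
  have h3 := abs_add_le (∫ x, u x ∂ν - ∫ x, v x ∂ν) (∫ x, v x ∂ν - ∫ x, v x ∂ν')
  rw [sub_add_sub_cancel] at h3
  linarith

/-- Normalisation turns a bound on the oscillation of a logarithmic density into a bound on
its size. -/
theorem abs_le_of_osc_le [IsProbabilityMeasure μ] [IsProbabilityMeasure ν]
    (hu : IsBddMeasurable u)
    (hν : ν = μ.withDensity fun x => ENNReal.ofReal (Real.exp (u x))) {x : X} {w : ℝ}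
    (h : ∀ᵐ y ∂μ, |u x - u y| ≤ w) : |u x| ≤ w := by
  have h1 := integral_exp_eq_one hu hν
  rw [abs_le]
  constructor
  · have : ∫ y, Real.exp (u y) ∂μ ≤ ∫ _, Real.exp (u x + w) ∂μ := by
      refine integral_mono_ae (hu.exp.integrable μ) (integrable_const _) ?_
      filter_upwards [h] with y hy
      exact Real.exp_le_exp.2 (by linarith [(abs_le.1 hy).1])
    rw [h1] at this
    simp only [integral_const, probReal_univ, one_smul, Real.one_le_exp_iff] at this
    linarith
  · have : ∫ _, Real.exp (u x - w) ∂μ ≤ ∫ y, Real.exp (u y) ∂μ := by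
      refine integral_mono_ae (integrable_const _) (hu.exp.integrable μ) ?_
      filter_upwards [h] with y hy
      exact Real.exp_le_exp.2 (by linarith [(abs_le.1 hy).2])
    rw [h1] at this
    simp only [integral_const, probReal_univ, one_smul, Real.exp_le_one_iff] at this
    linarith

theorem measurable_klDiv_kernel {S : Type*} [MeasurableSpace S]
    [MeasurableSpace.CountableOrCountablyGenerated S X] (κ η : Kernel S X) [IsFiniteKernel κ]
    [IsFiniteKernel η] : Measurable fun s => klDiv (κ s) (η s) := by
  classical
  have h : (fun s => klDiv (κ s) (η s)) = fun s => if κ s ≪ η s then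
      ∫⁻ x, ENNReal.ofReal (klFun (κ.rnDeriv η s x).toReal) ∂(η s) else ⊤ := by
    funext s
    rw [klDiv_eq_lintegral_klFun]
    refine if_ctx_congr Iff.rfl (fun _ => lintegral_congr_ae ?_) fun _ => rfl
    filter_upwards [Kernel.rnDeriv_eq_rnDeriv_measure (κ := κ) (η := η) (a := s)] with x hx
    rw [hx]
  rw [h]
  refine Measurable.ite (Kernel.measurableSet_absolutelyContinuous κ η) ?_ measurable_const
  refine Measurable.lintegral_kernel_prod_right' (κ := η)
    (f := fun p : S × X => ENNReal.ofReal (klFun (κ.rnDeriv η p.1 p.2).toReal)) ?_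
  exact (measurable_klFun.comp (Kernel.measurable_rnDeriv κ η).ennreal_toReal).ennreal_ofReal

end Gibbs

/-! ### Values as integrals against occupancy measures -/

section Value

variable {S A : Type*} [MeasurableSpace S] [MeasurableSpace A]

theorem measurable_klRef [MeasurableSpace.CountableOrCountablyGenerated S A] (M : MDP S A)
    (π : Policy S A) : Measurable (klRef M π) :=
  measurable_klDiv_kernel π.kernel (Kernel.const S M.μ)

theorem lintegral_pathLaw (M : MDP S A) (π : Policy S A) (s : S) (n : ℕ) {f : S → ENNReal}
    (hf : Measurable f) :
    ∫⁻ ω, f (ω n).1 ∂(pathLaw M π s) = ∫⁻ y, f y ∂((stateKernel M π ^ n) s) := by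
  have hf' : Measurable fun x : S × A => f x.1 := hf.comp measurable_fst
  have h := lintegral_map (μ := pathLaw M π s) (f := fun x : S × A => f x.1)
    (g := fun ω : ℕ → S × A => ω n) hf' (measurable_pi_apply n)
  rw [← h, pathLaw_map, Kernel.lintegral_comp _ _ _ hf']
  refine lintegral_congr fun y => ?_
  rw [Kernel.lintegral_id_prod hf']
  simp

theorem integral_pathLaw (M : MDP S A) (π : Policy S A) (s : S) (n : ℕ) {f : S × A → ℝ}
    (hf : IsBddMeasurable f) :
    ∫ ω, f (ω n) ∂(pathLaw M π s)
      = ∫ y, ∫ a, f (y, a) ∂(π.kernel y) ∂((stateKernel M π ^ n) s) := by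
  have h := integral_map (μ := pathLaw M π s) (φ := fun ω : ℕ → S × A => ω n) (f := f)
    (measurable_pi_apply n).aemeasurable hf.1.aestronglyMeasurable
  rw [← h, pathLaw_map, Kernel.comp_apply, hf.integral_bind]
  simp only [hf.integral_id_prod]

theorem integral_occupancy {X : Type*} [MeasurableSpace X] {γ : ℝ} (h0 : 0 ≤ γ) (h1 : γ < 1)
    (κ : Kernel X X) [IsMarkovKernel κ] {f : X → ℝ} (hf : IsBddMeasurable f) (x : X) :
    HasSum (fun n : ℕ => ((1 - γ) * γ ^ n) * ∫ y, f y ∂((κ ^ n) x))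
      (∫ y, f y ∂(occupancy γ κ x)) := by
  have := isMarkovKernel_occupancy h0 h1 κ
  have h := hasSum_integral_measure (hf.integrable (occupancy γ κ x))
  have e : ∀ n : ℕ, ∫ y, f y ∂(ENNReal.ofReal ((1 - γ) * γ ^ n) • (κ ^ n) x)
      = ((1 - γ) * γ ^ n) * ∫ y, f y ∂((κ ^ n) x) := fun n => by
    rw [integral_smul_measure, ENNReal.toReal_ofReal
      (mul_nonneg (by linarith) (pow_nonneg h0 n)), smul_eq_mul]
  rw [← funext e]
  exact h

theorem isProbabilityMeasure_bind_occupancy {X : Type*} [MeasurableSpace X] {γ : ℝ} (h0 : 0 ≤ γ)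
    (h1 : γ < 1) (κ : Kernel X X) [IsMarkovKernel κ] (m : Measure X) [IsProbabilityMeasure m] :
    IsProbabilityMeasure (m.bind (occupancy γ κ)) := by
  have := isMarkovKernel_occupancy h0 h1 κ
  infer_instance

theorem entropyValue_eq [MeasurableSpace.CountableOrCountablyGenerated S A] (M : MDP S A)
    {γ : ℝ} (h1 : γ < 1) {τ : ℝ} (hτ : 0 ≤ τ) (π : Policy S A) (s : S) :
    entropyValue M γ τ π s = ENNReal.ofReal (τ / (1 - γ))
      * ∫⁻ y, klRef M π y ∂(occupancy γ (stateKernel M π) s) := by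
  have hm := measurable_klRef M π
  have hn : ∀ n : ℕ, Measurable fun ω : ℕ → S × A => klRef M π (ω n).1 := fun n =>
    hm.comp (measurable_fst.comp (measurable_pi_apply n))
  rw [entropyValue, lintegral_tsum fun n => ((hn n).const_mul _).aemeasurable,
    lintegral_occupancy, ← ENNReal.tsum_mul_left]
  refine tsum_congr fun n => ?_
  rw [lintegral_const_mul _ (hn n),
    lintegral_pathLaw M π s n hm, ← mul_assoc, ← ENNReal.ofReal_mul
      (div_nonneg hτ (by linarith))]
  congr 2
  have : (1 - γ) ≠ 0 := by linarith
  field_simp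

theorem costValue_eq (M : MDP S A) {γ : ℝ} (h0 : 0 ≤ γ) (h1 : γ < 1) (π : Policy S A) (s : S) :
    costValue M γ π s
      = (1 - γ)⁻¹ * ∫ y, ∫ a, M.c (y, a) ∂(π.kernel y) ∂(occupancy γ (stateKernel M π) s) := by
  have hc := M.isBdd_c
  have hcb := hc.integral_prod π.kernel
  have hne : 1 - γ ≠ 0 := by linarith
  obtain ⟨C, hC⟩ := hc.2
  have hP : IsProbabilityMeasure (pathLaw M π s) := by unfold pathLaw; infer_instance
  have hI : ∀ n : ℕ, IsBddMeasurable fun ω : ℕ → S × A => γ ^ n * M.c (ω n) := fun n =>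
    (hc.comp (measurable_pi_apply n)).const_mul _
  have h2 := hasSum_integral_of_summable_integral_norm (μ := pathLaw M π s)
    (F := fun (n : ℕ) ω => γ ^ n * M.c (ω n)) (fun n => (hI n).integrable _) (by
      refine Summable.of_nonneg_of_le (fun n => integral_nonneg fun _ => norm_nonneg _)
        (fun n => ?_) ((summable_geometric_of_lt_one h0 h1).mul_right C)
      refine (le_abs_self _).trans (abs_integral_le_of_ae (ae_of_all _ fun ω => ?_))
      rw [abs_norm, norm_mul, norm_pow, Real.norm_of_nonneg h0]
      exact mul_le_mul_of_nonneg_left (hC _) (pow_nonneg h0 n))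
  have h3 := (integral_occupancy h0 h1 (stateKernel M π) hcb s).mul_left (1 - γ)⁻¹
  have e : ∀ n : ℕ, ∫ ω, γ ^ n * M.c (ω n) ∂(pathLaw M π s) = (1 - γ)⁻¹ * ((1 - γ) * γ ^ n
      * ∫ y, ∫ a, M.c (y, a) ∂(π.kernel y) ∂((stateKernel M π ^ n) s)) := fun n => by
    rw [integral_const_mul, integral_pathLaw M π s n hc]
    field_simp
  rw [← funext e] at h3
  exact h2.unique h3

theorem lintegral_entropyValue [MeasurableSpace.CountableOrCountablyGenerated S A] (M : MDP S A)
    {γ : ℝ} (h1 : γ < 1) {τ : ℝ} (hτ : 0 ≤ τ) (π : Policy S A) (ρ : Measure S) :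
    ∫⁻ s, entropyValue M γ τ π s ∂ρ = ENNReal.ofReal (τ / (1 - γ))
      * ∫⁻ y, klRef M π y ∂(stateOccupancy M γ π ρ) := by
  have hm := measurable_klRef M π
  simp only [entropyValue_eq M h1 hτ]
  rw [lintegral_const_mul _ hm.lintegral_kernel, stateOccupancy,
    Measure.lintegral_bind (Kernel.aemeasurable _) hm.aemeasurable]

theorem integral_costValue (M : MDP S A) {γ : ℝ} (h0 : 0 ≤ γ) (h1 : γ < 1) (π : Policy S A)
    (ρ : Measure S) [IsProbabilityMeasure ρ] :
    ∫ s, costValue M γ π s ∂ρ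
      = (1 - γ)⁻¹ * ∫ y, ∫ a, M.c (y, a) ∂(π.kernel y) ∂(stateOccupancy M γ π ρ) := by
  have := isMarkovKernel_occupancy h0 h1 (stateKernel M π)
  simp only [costValue_eq M h0 h1]
  rw [integral_const_mul, stateOccupancy, (M.isBdd_c.integral_prod π.kernel).integral_bind]

/-! ### Regularised values of policies with bounded log-density -/

/-- The expected one-step cost `∫ (c + τ ln dπ/dμ) dπ(·|s)`, where `u = ln dπ/dμ`. -/
noncomputable def regCost (M : MDP S A) (τ : ℝ) (π : Policy S A) (u : S × A → ℝ) (s : S) : ℝ :=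
  ∫ a, (M.c (s, a) + τ * u (s, a)) ∂(π.kernel s)

/-- The real-valued regularised value function of a policy with log-density `u`, written as an
integral against the occupancy measure. -/
noncomputable def regValue (M : MDP S A) (γ τ : ℝ) (π : Policy S A) (u : S × A → ℝ) (s : S) : ℝ :=
  (1 - γ)⁻¹ * ∫ y, regCost M τ π u y ∂(occupancy γ (stateKernel M π) s)

variable {M : MDP S A} {γ τ : ℝ} {π : Policy S A} {u : S × A → ℝ}

theorem IsLogDensity.section_bdd (hu : IsLogDensity M.μ π u) (s : S) :
    IsBddMeasurable fun a => u (s, a) := hu.1.comp measurable_prodMk_left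

theorem isBdd_regCost (hu : IsLogDensity M.μ π u) : IsBddMeasurable (regCost M τ π u) :=
  (M.isBdd_c.add (hu.1.const_mul τ)).integral_prod π.kernel

theorem regCost_eq (hu : IsLogDensity M.μ π u) (s : S) :
    regCost M τ π u s
      = ∫ a, M.c (s, a) ∂(π.kernel s) + τ * ∫ a, u (s, a) ∂(π.kernel s) := by
  rw [regCost, integral_add ((M.isBdd_c.comp measurable_prodMk_left).integrable _)
    (((hu.section_bdd s).const_mul τ).integrable _), integral_const_mul]

theorem isBdd_regValue (h0 : 0 ≤ γ) (h1 : γ < 1) (hu : IsLogDensity M.μ π u) :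
    IsBddMeasurable (regValue M γ τ π u) := by
  have := isMarkovKernel_occupancy h0 h1 (stateKernel M π)
  exact ((isBdd_regCost hu).integral_kernel _).const_mul _

theorem klRef_eq (hu : IsLogDensity M.μ π u) (s : S) :
    klRef M π s = ENNReal.ofReal (∫ a, u (s, a) ∂(π.kernel s)) :=
  klDiv_gibbs_ref (hu.section_bdd s) (hu.2 s)

theorem integral_logDensity_nonneg (hu : IsLogDensity M.μ π u) (s : S) :
    0 ≤ ∫ a, u (s, a) ∂(π.kernel s) := by
  -- `klRef_eq` truncates at zero; nonnegativity is Gibbs' inequality, from `e^u - 1 ≤ u e^u`.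
  have h1 := integral_exp_eq_one (hu.section_bdd s) (hu.2 s)
  have hb := hu.section_bdd s
  rw [integral_gibbs hb (hu.2 s)]
  have h2 : ∫ a, (Real.exp (u (s, a)) - 1) ∂M.μ ≤ ∫ a, Real.exp (u (s, a)) * u (s, a) ∂M.μ := by
    refine integral_mono ((hb.exp.integrable _).sub (integrable_const _))
      ((hb.exp.mul hb).integrable _) fun a => ?_
    have h3 := Real.add_one_le_exp (-u (s, a))
    have h4 := mul_le_mul_of_nonneg_left h3 (Real.exp_pos (u (s, a))).le
    rw [← Real.exp_add, add_neg_cancel, Real.exp_zero] at h4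
    change Real.exp (u (s, a)) - 1 ≤ Real.exp (u (s, a)) * u (s, a)
    linarith
  rw [integral_sub (hb.exp.integrable _) (integrable_const _), h1] at h2
  simpa using h2

theorem klRef_toReal (hu : IsLogDensity M.μ π u) (s : S) :
    (klRef M π s).toReal = ∫ a, u (s, a) ∂(π.kernel s) := by
  rw [klRef_eq hu, ENNReal.toReal_ofReal (integral_logDensity_nonneg hu s)]

/-- The bounded entropy of a policy with log-density `u`, integrated in `[0, ∞]`. -/
theorem ofReal_mul_lintegral_klRef (hτ : 0 ≤ τ) (h1 : γ < 1) (hu : IsLogDensity M.μ π u)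
    (m : Measure S) [IsProbabilityMeasure m] :
    ENNReal.ofReal (τ / (1 - γ)) * ∫⁻ s, klRef M π s ∂m
      = ENNReal.ofReal ((1 - γ)⁻¹ * (τ * ∫ s, ∫ a, u (s, a) ∂(π.kernel s) ∂m)) := by
  simp only [klRef_eq hu]
  rw [← ofReal_integral_eq_lintegral_ofReal ((hu.1.integral_prod π.kernel).integrable m)
    (ae_of_all _ fun s => integral_logDensity_nonneg hu s),
    ← ENNReal.ofReal_mul (div_nonneg hτ (by linarith))]
  congr 1
  rw [div_eq_mul_inv]
  ring

theorem integral_regCost (hu : IsLogDensity M.μ π u) (m : Measure S) [IsProbabilityMeasure m] :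
    ∫ s, regCost M τ π u s ∂m = ∫ s, ∫ a, M.c (s, a) ∂(π.kernel s) ∂m
      + τ * ∫ s, ∫ a, u (s, a) ∂(π.kernel s) ∂m := by
  simp only [regCost_eq hu]
  rw [integral_add ((M.isBdd_c.integral_prod π.kernel).integrable m)
    (((hu.1.integral_prod π.kernel).const_mul τ).integrable m), integral_const_mul]

theorem value_eq [MeasurableSpace.CountableOrCountablyGenerated S A] (h0 : 0 ≤ γ) (h1 : γ < 1)
    (hτ : 0 ≤ τ) (hu : IsLogDensity M.μ π u) (s : S) :
    value M γ τ π s = (regValue M γ τ π u s : EReal) := by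
  have := isMarkovKernel_occupancy h0 h1 (stateKernel M π)
  rw [value, entropyValue_eq M h1 hτ, ofReal_mul_lintegral_klRef hτ h1 hu, costValue_eq M h0 h1,
    regValue, integral_regCost hu, EReal.coe_ennreal_ofReal, max_eq_left, ← EReal.coe_add, mul_add]
  exact mul_nonneg (inv_nonneg.2 (by linarith)) (mul_nonneg hτ
    (integral_nonneg fun y => integral_logDensity_nonneg hu y))

theorem integral_regValue (h0 : 0 ≤ γ) (h1 : γ < 1) (hu : IsLogDensity M.μ π u)
    (ρ : Measure S) [IsProbabilityMeasure ρ] :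
    ∫ s, regValue M γ τ π u s ∂ρ
      = (1 - γ)⁻¹ * ∫ y, regCost M τ π u y ∂(stateOccupancy M γ π ρ) := by
  have := isMarkovKernel_occupancy h0 h1 (stateKernel M π)
  simp only [regValue]
  rw [integral_const_mul, stateOccupancy, (isBdd_regCost hu).integral_bind]

theorem valueAt_eq [MeasurableSpace.CountableOrCountablyGenerated S A] (h0 : 0 ≤ γ) (h1 : γ < 1)
    (hτ : 0 ≤ τ) (hu : IsLogDensity M.μ π u) (ρ : Measure S) [IsProbabilityMeasure ρ] :
    valueAt M γ τ π ρ = ((∫ s, regValue M γ τ π u s ∂ρ : ℝ) : EReal) := by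
  have : IsProbabilityMeasure (stateOccupancy M γ π ρ) :=
    isProbabilityMeasure_bind_occupancy h0 h1 _ ρ
  rw [valueAt, lintegral_entropyValue M h1 hτ, ofReal_mul_lintegral_klRef hτ h1 hu,
    integral_costValue M h0 h1, integral_regValue h0 h1 hu, integral_regCost hu,
    EReal.coe_ennreal_ofReal, max_eq_left, ← EReal.coe_add, mul_add]
  exact mul_nonneg (inv_nonneg.2 (by linarith)) (mul_nonneg hτ
    (integral_nonneg fun y => integral_logDensity_nonneg hu y))

/-- Expansion of an integral against a measure solving the balance equation. -/
theorem integral_balance {X : Type*} [MeasurableSpace X] (h0 : 0 ≤ γ) (h1 : γ < 1)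
    {d m m' : Measure X} [IsProbabilityMeasure m] [IsProbabilityMeasure m']
    (hd : d = ENNReal.ofReal (1 - γ) • m + ENNReal.ofReal γ • m')
    {f : X → ℝ} (hf : IsBddMeasurable f) :
    ∫ x, f x ∂d = (1 - γ) * ∫ x, f x ∂m + γ * ∫ x, f x ∂m' := by
  rw [hd, integral_add_measure ((hf.integrable m).smul_measure ENNReal.ofReal_ne_top)
    ((hf.integrable m').smul_measure ENNReal.ofReal_ne_top), integral_smul_measure,
    integral_smul_measure, ENNReal.toReal_ofReal (by linarith), ENNReal.toReal_ofReal h0]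
  simp

/-- The Bellman equation for the regularised value function. -/
theorem regValue_eq (h0 : 0 ≤ γ) (h1 : γ < 1) (hu : IsLogDensity M.μ π u) (s : S) :
    regValue M γ τ π u s
      = regCost M τ π u s + γ * ∫ s', regValue M γ τ π u s' ∂(stateKernel M π s) := by
  have := isMarkovKernel_occupancy h0 h1 (stateKernel M π)
  have hne : 1 - γ ≠ 0 := by linarith
  have hb := isBdd_regCost (τ := τ) hu
  rw [regValue, integral_balance h0 h1 (occupancy_eq_first_step h0 (stateKernel M π) s) hb,
    hb.integral_bind]
  simp only [regValue]
  rw [integral_const_mul, integral_dirac' _ _ hb.1.stronglyMeasurable]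
  field_simp

theorem integral_stateKernel {f : S → ℝ} (hf : IsBddMeasurable f) (s : S) :
    ∫ s', f s' ∂(stateKernel M π s)
      = ∫ a, ∫ s', f s' ∂(M.P (s, a)) ∂(π.kernel s) := by
  rw [stateKernel, Kernel.comp_apply, hf.integral_bind, (hf.integral_kernel M.P).integral_id_prod]

theorem integral_stateActionKernel {f : S × A → ℝ} (hf : IsBddMeasurable f) (x : S × A) :
    ∫ y, f y ∂(stateActionKernel M π x) = ∫ s', ∫ a', f (s', a') ∂(π.kernel s') ∂(M.P x) := by
  rw [stateActionKernel_eq_comp, Kernel.comp_apply, hf.integral_bind]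
  simp only [hf.integral_id_prod]

variable [MeasurableSpace.CountableOrCountablyGenerated S A]

theorem qFun_eq (h0 : 0 ≤ γ) (h1 : γ < 1) (hτ : 0 ≤ τ) (hu : IsLogDensity M.μ π u) (x : S × A) :
    qFun M γ τ π x = M.c x + γ * ∫ s', regValue M γ τ π u s' ∂(M.P x) := by
  simp only [qFun, value_eq h0 h1 hτ hu, EReal.toReal_coe]

theorem isBdd_qFun (h0 : 0 ≤ γ) (h1 : γ < 1) (hτ : 0 ≤ τ) (hu : IsLogDensity M.μ π u) :
    IsBddMeasurable (qFun M γ τ π) := by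
  rw [funext (qFun_eq h0 h1 hτ hu)]
  exact M.isBdd_c.add (((isBdd_regValue h0 h1 hu).integral_kernel M.P).const_mul γ)

theorem regValue_eq_integral_qFun (h0 : 0 ≤ γ) (h1 : γ < 1) (hτ : 0 ≤ τ)
    (hu : IsLogDensity M.μ π u) (s : S) :
    regValue M γ τ π u s
      = ∫ a, qFun M γ τ π (s, a) ∂(π.kernel s) + τ * ∫ a, u (s, a) ∂(π.kernel s) := by
  have hV := isBdd_regValue (τ := τ) h0 h1 hu
  rw [regValue_eq h0 h1 hu, regCost_eq hu, integral_stateKernel hV]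
  simp only [qFun_eq h0 h1 hτ hu]
  rw [integral_add ((M.isBdd_c.comp measurable_prodMk_left).integrable _)
    ((((hV.integral_kernel M.P).comp measurable_prodMk_left).const_mul γ).integrable _),
    integral_const_mul]
  ring

/-- `Q^π_τ` is a fixed point of `T^π`. -/
theorem bellman_qFun (h0 : 0 ≤ γ) (h1 : γ < 1) (hτ : 0 ≤ τ) (hu : IsLogDensity M.μ π u)
    (x : S × A) : bellman M γ τ π (qFun M γ τ π) x = qFun M γ τ π x := by
  have hq := isBdd_qFun h0 h1 hτ hu
  rw [bellman, integral_stateActionKernel hq, qFun_eq h0 h1 hτ hu]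
  simp only [regValue_eq_integral_qFun h0 h1 hτ hu, klRef_toReal hu]
  rw [integral_add ((hq.integral_prod π.kernel).integrable _)
    (((hu.1.integral_prod π.kernel).const_mul τ).integrable _), integral_const_mul]
  ring

end Value

/-! ### Coercivity of the semi-gradient -/

theorem abs_qLin_le {S A : Type*} {N : ℕ} {φ : S × A → EuclideanSpace ℝ (Fin N)}
    (hφ : ∀ x, ‖φ x‖ ≤ 1) (θ : EuclideanSpace ℝ (Fin N)) (x : S × A) :
    |qLin φ θ x| ≤ ‖θ‖ :=
  (abs_real_inner_le_norm θ (φ x)).trans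
    (mul_le_of_le_one_right (norm_nonneg θ) (hφ x))

theorem qLin_sub {S A : Type*} {N : ℕ} {φ : S × A → EuclideanSpace ℝ (Fin N)}
    (θ θ' : EuclideanSpace ℝ (Fin N)) (x : S × A) :
    qLin φ (θ - θ') x = qLin φ θ x - qLin φ θ' x := inner_sub_left _ _ _

section Critic

variable {S A : Type*} [MeasurableSpace S] [MeasurableSpace A] {N : ℕ}

theorem lambdaMin_mul_le {B : Matrix (Fin N) (Fin N) ℝ} (hB : B.IsHermitian) (x : Fin N → ℝ) :
    lambdaMin B * dotProduct x x ≤ dotProduct x (B.mulVec x) := by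
  have h : (B - algebraMap ℝ _ (lambdaMin B)).PosSemidef := by
    rw [Matrix.posSemidef_iff_isHermitian_and_spectrum_nonneg]
    refine ⟨hB.sub ?_, ?_⟩
    · rw [Algebra.algebraMap_eq_smul_one]
      simp [Matrix.IsHermitian]
    · rw [← spectrum.sub_singleton_eq]
      rintro _ ⟨a, ha, b, rfl, rfl⟩
      exact sub_nonneg.2 (csInf_le (Set.toFinite (spectrum ℝ B)).bddBelow ha)
  have h2 := h.dotProduct_mulVec_nonneg x
  rw [Matrix.sub_mulVec, Algebra.algebraMap_eq_smul_one, Matrix.smul_mulVec, Matrix.one_mulVec,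
    dotProduct_sub, dotProduct_smul] at h2
  simpa using h2

variable {φ : S × A → EuclideanSpace ℝ (Fin N)}

theorem isBdd_qLin (hm : Measurable φ) (hφ : ∀ x, ‖φ x‖ ≤ 1) (θ : EuclideanSpace ℝ (Fin N)) :
    IsBddMeasurable (qLin φ θ) :=
  ⟨hm.const_inner, ‖θ‖, abs_qLin_le hφ θ⟩

theorem lambdaBeta_mul_sq_le (hm : Measurable φ) (hφ : ∀ x, ‖φ x‖ ≤ 1) (β : Measure (S × A))
    [IsProbabilityMeasure β] (w : EuclideanSpace ℝ (Fin N)) :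
    lambdaBeta φ β * ‖w‖ ^ 2 ≤ ∫ x, qLin φ w x ^ 2 ∂β := by
  have hcoord : ∀ i, IsBddMeasurable fun x => φ x i := fun i => by
    have := isBdd_qLin hm hφ (EuclideanSpace.single i (1 : ℝ))
    have e : (fun x => φ x i) = qLin φ (EuclideanSpace.single i (1 : ℝ)) := by
      funext x
      simp [qLin, EuclideanSpace.inner_single_left]
    rw [e]
    exact this
  set B : Matrix (Fin N) (Fin N) ℝ := Matrix.of fun i j => ∫ x, φ x i * φ x j ∂β with hBdef
  have hB : B.IsHermitian := by
    ext i j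
    simp only [hBdef, Matrix.conjTranspose_apply, Matrix.of_apply, star_trivial, mul_comm]
  have h := lambdaMin_mul_le hB w.ofLp
  have h1 : dotProduct w.ofLp w.ofLp = ‖w‖ ^ 2 := by
    rw [EuclideanSpace.norm_sq_eq]
    simp [dotProduct, sq]
  have h2 : dotProduct w.ofLp (B.mulVec w.ofLp) = ∫ x, qLin φ w x ^ 2 ∂β := by
    have h3 : ∀ x, qLin φ w x ^ 2 = ∑ i, ∑ j, w i * w j * (φ x i * φ x j) := fun x => by
      rw [qLin, PiLp.inner_apply, sq, Finset.sum_mul_sum]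
      refine Finset.sum_congr rfl fun i _ => Finset.sum_congr rfl fun j _ => ?_
      simp only [RCLike.inner_apply, conj_trivial]
      ring
    simp only [h3]
    have hi : ∀ i j, Integrable (fun x => w i * w j * (φ x i * φ x j)) β := fun i j =>
      (((hcoord i).mul (hcoord j)).const_mul _).integrable β
    rw [integral_finsetSum _ fun i _ => integrable_finsetSum _ fun j _ => hi i j]
    simp only [dotProduct, Matrix.mulVec, Finset.mul_sum]
    refine Finset.sum_congr rfl fun i _ => ?_
    rw [integral_finsetSum _ fun j _ => hi i j]
    refine Finset.sum_congr rfl fun j _ => ?_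
    rw [integral_const_mul]
    simp only [hBdef, Matrix.of_apply]
    ring
  rw [h1, h2] at h
  exact h

/-- A linear function of the features that is uniformly small has a small parameter. -/
theorem lambdaBeta_mul_norm_le (hm : Measurable φ) (hφ : ∀ x, ‖φ x‖ ≤ 1) (β : Measure (S × A))
    [IsProbabilityMeasure β] (hβ : 0 < lambdaBeta φ β) (w : EuclideanSpace ℝ (Fin N)) {D : ℝ}
    (hD0 : 0 ≤ D) (hD : ∀ x, |qLin φ w x| ≤ D) : lambdaBeta φ β * ‖w‖ ≤ D := by
  have h1 := lambdaBeta_mul_sq_le hm hφ β w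
  have hb : ∀ C : ℝ, 0 ≤ C → (∀ x, |qLin φ w x| ≤ C) → ∫ x, qLin φ w x ^ 2 ∂β ≤ C ^ 2 := by
    intro C hC0 hC
    refine (le_abs_self _).trans (abs_integral_le_of_ae (ae_of_all _ fun x => ?_))
    rw [abs_pow]
    exact pow_le_pow_left₀ (abs_nonneg _) (hC x) 2
  have h2 := h1.trans (hb D hD0 hD)
  have h3 := h1.trans (hb ‖w‖ (norm_nonneg w) (abs_qLin_le hφ w))
  rcases eq_or_lt_of_le (norm_nonneg w) with h0 | h0
  · rw [← h0, mul_zero]; exact hD0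
  · have h4 : lambdaBeta φ β ≤ 1 := by
      have : 0 < ‖w‖ ^ 2 := by positivity
      by_contra! h
      nlinarith
    refine le_of_sq_le_sq ?_ hD0
    calc (lambdaBeta φ β * ‖w‖) ^ 2 = lambdaBeta φ β * (lambdaBeta φ β * ‖w‖ ^ 2) := by ring
      _ ≤ 1 * (lambdaBeta φ β * ‖w‖ ^ 2) := mul_le_mul_of_nonneg_right h4 (by positivity)
      _ ≤ D ^ 2 := by linarith

theorem sq_integral_le {X : Type*} [MeasurableSpace X] {m : Measure X} [IsProbabilityMeasure m]
    {h : X → ℝ} (hb : IsBddMeasurable h) : (∫ x, h x ∂m) ^ 2 ≤ ∫ x, h x ^ 2 ∂m := by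
  set I := ∫ x, h x ∂m with hI
  have h2 : IsBddMeasurable fun x => h x ^ 2 := by simpa [sq] using hb.mul hb
  have h0 : 0 ≤ ∫ x, (h x - I) ^ 2 ∂m := integral_nonneg fun x => sq_nonneg _
  have h1 : ∀ x, (h x - I) ^ 2 = h x ^ 2 + -(2 * I) * h x + I ^ 2 := fun x => by ring
  simp only [h1] at h0
  rw [integral_add ((h2.add (hb.const_mul _)).integrable m) (integrable_const _),
    integral_add (h2.integrable m) ((hb.const_mul _).integrable m), integral_const_mul] at h0
  simp only [integral_const, probReal_univ, one_smul] at h0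
  rw [← hI] at h0
  nlinarith

/-- Coercivity of `I - γ κ` in the `L²` space of an occupancy measure. The balance equation gives
`γ d κ ≤ d`, so that `κ` has norm at most `1 / √γ` there. -/
theorem coercive_occupancy {X : Type*} [MeasurableSpace X] {γ : ℝ} (h0 : 0 ≤ γ) (h1 : γ < 1)
    (κ : Kernel X X) [IsMarkovKernel κ] (m : Measure X) [IsProbabilityMeasure m]
    {h : X → ℝ} (hb : IsBddMeasurable h) :
    (1 - γ) * (1 - √γ) * ∫ x, h x ^ 2 ∂m
      ≤ ∫ x, (h x - γ * ∫ y, h y ∂(κ x)) * h x ∂(m.bind (occupancy γ κ)) := by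
  have := isMarkovKernel_occupancy h0 h1 κ
  have hd : IsProbabilityMeasure (m.bind (occupancy γ κ)) :=
    isProbabilityMeasure_bind_occupancy h0 h1 κ m
  set d := m.bind (occupancy γ κ) with hddef
  have h2 : IsBddMeasurable fun x => h x ^ 2 := by simpa [sq] using hb.mul hb
  have hκ := hb.integral_kernel κ
  have hκ2 : IsBddMeasurable fun x => (∫ y, h y ∂(κ x)) ^ 2 := by simpa [sq] using hκ.mul hκ
  have hbal := integral_balance h0 h1 (bind_occupancy_eq h0 κ m) h2
  rw [← hddef, h2.integral_bind d κ] at hbal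
  have hJ : ∫ x, (∫ y, h y ∂(κ x)) ^ 2 ∂d ≤ ∫ x, ∫ y, h y ^ 2 ∂(κ x) ∂d :=
    integral_mono (hκ2.integrable d) ((h2.integral_kernel κ).integrable d)
      fun x => sq_integral_le hb
  have hs : √γ * √γ = γ := Real.mul_self_sqrt h0
  have hs0 : 0 ≤ √γ := Real.sqrt_nonneg γ
  have hs1 : √γ ≤ 1 := Real.sqrt_le_one.2 h1.le
  have hpt : ∀ x, (1 - √γ / 2) * h x ^ 2 - γ * √γ / 2 * (∫ y, h y ∂(κ x)) ^ 2
      ≤ (h x - γ * ∫ y, h y ∂(κ x)) * h x := fun x => by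
    set k := ∫ y, h y ∂(κ x)
    have h3 : 0 ≤ √γ / 2 * (h x - √γ * k) ^ 2 := by positivity
    have h4 : √γ / 2 * (h x - √γ * k) ^ 2
        = √γ / 2 * h x ^ 2 - (√γ * √γ) * k * h x + (√γ * √γ) * √γ / 2 * k ^ 2 := by ring
    rw [h4, hs] at h3
    linarith
  have hint := integral_mono (μ := d) (((h2.const_mul _).sub (hκ2.const_mul _)).integrable d)
    (((hb.sub (hκ.const_mul γ)).mul hb).integrable d) hpt
  rw [integral_sub ((h2.const_mul _).integrable d) ((hκ2.const_mul _).integrable d),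
    integral_const_mul, integral_const_mul] at hint
  have hm0 : 0 ≤ ∫ x, h x ^ 2 ∂m := integral_nonneg fun x => sq_nonneg _
  set I := ∫ x, h x ^ 2 ∂d
  set K := ∫ x, (∫ y, h y ∂(κ x)) ^ 2 ∂d
  set K' := ∫ x, ∫ y, h y ^ 2 ∂(κ x) ∂d
  set I0 := ∫ x, h x ^ 2 ∂m
  have hK'0 : 0 ≤ K' := integral_nonneg fun x => integral_nonneg fun y => sq_nonneg _
  have h5 : √γ / 2 * (γ * K) ≤ √γ / 2 * (γ * K') :=
    mul_le_mul_of_nonneg_left (mul_le_mul_of_nonneg_left hJ h0) (by positivity)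
  have h6 : γ * K' ≤ I := by
    have : 0 ≤ (1 - γ) * I0 := mul_nonneg (by linarith) hm0
    linarith
  have h7 : √γ / 2 * (γ * K') ≤ √γ / 2 * I := mul_le_mul_of_nonneg_left h6 (by positivity)
  have h8 : (1 - γ) * I0 ≤ I := by
    have : 0 ≤ γ * K' := mul_nonneg h0 hK'0
    linarith
  have h9 : (1 - √γ) * ((1 - γ) * I0) ≤ (1 - √γ) * I :=
    mul_le_mul_of_nonneg_left h8 (by linarith)
  nlinarith

variable {M : MDP S A} {γ τ : ℝ} {π : Policy S A} {u : S × A → ℝ}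

theorem isBdd_bellman (hu : IsLogDensity M.μ π u) {f : S × A → ℝ} (hf : IsBddMeasurable f) :
    IsBddMeasurable (bellman M γ τ π f) := by
  have h : IsBddMeasurable fun s => (klRef M π s).toReal := by
    rw [funext (klRef_toReal hu)]
    exact hu.1.integral_prod π.kernel
  exact (M.isBdd_c.add ((hf.integral_kernel _).const_mul γ)).add
    ((h.integral_kernel M.P).const_mul (τ * γ))

theorem inner_semiGrad (hm : Measurable φ) (hφ : ∀ x, ‖φ x‖ ≤ 1) (h0 : 0 ≤ γ) (h1 : γ < 1)
    (β : Measure (S × A)) [IsProbabilityMeasure β] (hu : IsLogDensity M.μ π u)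
    (θ w : EuclideanSpace ℝ (Fin N)) :
    inner ℝ w (semiGrad M γ τ φ β θ π)
      = ∫ x, (qLin φ θ x - bellman M γ τ π (qLin φ θ) x) * qLin φ w x
          ∂(stateActionOccupancy M γ π β) := by
  have hd : IsProbabilityMeasure (stateActionOccupancy M γ π β) :=
    isProbabilityMeasure_bind_occupancy h0 h1 _ β
  have hq := isBdd_qLin hm hφ θ
  obtain ⟨hrm, C, hC⟩ := hq.sub (isBdd_bellman (γ := γ) (τ := τ) hu hq)
  rw [semiGrad, ← integral_inner]
  · refine integral_congr_ae (ae_of_all _ fun x => ?_)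
    simp [qLin, inner_smul_right]
  · refine Integrable.of_bound (hrm.smul hm).aestronglyMeasurable C (ae_of_all _ fun x => ?_)
    rw [norm_smul]
    exact (mul_le_of_le_one_right (norm_nonneg _) (hφ x)).trans (hC x)

theorem coercive_qLin (hm : Measurable φ) (hφ : ∀ x, ‖φ x‖ ≤ 1) (h0 : 0 ≤ γ) (h1 : γ < 1)
    (β : Measure (S × A)) [IsProbabilityMeasure β] (w : EuclideanSpace ℝ (Fin N)) :
    bigGamma γ φ β * ‖w‖ ^ 2
      ≤ ∫ x, (qLin φ w x - γ * ∫ y, qLin φ w y ∂(stateActionKernel M π x)) * qLin φ w x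
          ∂(stateActionOccupancy M γ π β) := by
  refine le_trans ?_ (coercive_occupancy h0 h1 (stateActionKernel M π) β (isBdd_qLin hm hφ w))
  have h2 := lambdaBeta_mul_sq_le hm hφ β w
  have h3 : 0 ≤ (1 - γ) * (1 - √γ) :=
    mul_nonneg (by linarith) (by linarith [Real.sqrt_le_one.2 h1.le])
  calc bigGamma γ φ β * ‖w‖ ^ 2 = (1 - γ) * (1 - √γ) * (lambdaBeta φ β * ‖w‖ ^ 2) := by
        rw [bigGamma]; ring
    _ ≤ _ := mul_le_mul_of_nonneg_left h2 h3

/-- The semi-gradient points away from the parameter that represents `Q^π_τ`. -/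
theorem inner_semiGrad_sub_ge [MeasurableSpace.CountableOrCountablyGenerated S A]
    (hm : Measurable φ) (hφ : ∀ x, ‖φ x‖ ≤ 1) (h0 : 0 ≤ γ) (h1 : γ < 1) (hτ : 0 ≤ τ)
    (β : Measure (S × A)) [IsProbabilityMeasure β] (hu : IsLogDensity M.μ π u)
    (θ : EuclideanSpace ℝ (Fin N)) {θ' : EuclideanSpace ℝ (Fin N)}
    (hθ' : ∀ x, qFun M γ τ π x = qLin φ θ' x) :
    bigGamma γ φ β * ‖θ - θ'‖ ^ 2 ≤ inner ℝ (θ - θ') (semiGrad M γ τ φ β θ π) := by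
  rw [inner_semiGrad hm hφ h0 h1 β hu]
  refine (coercive_qLin (M := M) (π := π) hm hφ h0 h1 β (θ - θ')).trans (le_of_eq ?_)
  refine integral_congr_ae (ae_of_all _ fun x => ?_)
  have hq := isBdd_qLin hm hφ θ
  have hq' := isBdd_qLin hm hφ θ'
  have hfix := bellman_qFun h0 h1 hτ hu x
  rw [funext hθ'] at hfix
  simp only [bellman, qLin_sub] at hfix ⊢
  rw [integral_sub (hq.integrable _) (hq'.integrable _)]
  congr 1
  linear_combination hfix

theorem inner_semiGrad_self_ge (hm : Measurable φ) (hφ : ∀ x, ‖φ x‖ ≤ 1) (h0 : 0 ≤ γ)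
    (h1 : γ < 1) (hτ : 0 ≤ τ) (β : Measure (S × A)) [IsProbabilityMeasure β]
    (hu : IsLogDensity M.μ π u) {C E : ℝ} (hC : ∀ x, |M.c x| ≤ C)
    (hE : ∀ s, |∫ a, u (s, a) ∂(π.kernel s)| ≤ E) (θ : EuclideanSpace ℝ (Fin N)) :
    bigGamma γ φ β * ‖θ‖ ^ 2 - (C + τ * E) * ‖θ‖ ≤ inner ℝ θ (semiGrad M γ τ φ β θ π) := by
  have hd : IsProbabilityMeasure (stateActionOccupancy M γ π β) :=
    isProbabilityMeasure_bind_occupancy h0 h1 _ β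
  rw [inner_semiGrad hm hφ h0 h1 β hu]
  have hq := isBdd_qLin hm hφ θ
  have hent : IsBddMeasurable fun x => ∫ s', ∫ a, u (s', a) ∂(π.kernel s') ∂(M.P x) :=
    (hu.1.integral_prod π.kernel).integral_kernel M.P
  have hr := M.isBdd_c.add (hent.const_mul (τ * γ))
  have h2 := coercive_qLin (M := M) (π := π) hm hφ h0 h1 β θ
  have e : ∀ x, (qLin φ θ x - bellman M γ τ π (qLin φ θ) x) * qLin φ θ x
      = (qLin φ θ x - γ * ∫ y, qLin φ θ y ∂(stateActionKernel M π x)) * qLin φ θ x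
        - (M.c x + τ * γ * ∫ s', ∫ a, u (s', a) ∂(π.kernel s') ∂(M.P x)) * qLin φ θ x := by
    intro x
    simp only [bellman, klRef_toReal hu]
    ring
  simp only [e]
  rw [integral_sub (((hq.sub ((hq.integral_kernel _).const_mul γ)).mul hq).integrable _)
    ((hr.mul hq).integrable _)]
  have h3 : |∫ x, (M.c x + τ * γ * ∫ s', ∫ a, u (s', a) ∂(π.kernel s') ∂(M.P x)) * qLin φ θ x
      ∂(stateActionOccupancy M γ π β)| ≤ (C + τ * E) * ‖θ‖ := by
    refine abs_integral_le_of_ae (ae_of_all _ fun x => ?_)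
    rw [abs_mul]
    have h4 : |∫ s', ∫ a, u (s', a) ∂(π.kernel s') ∂(M.P x)| ≤ E :=
      abs_integral_le_of_ae (ae_of_all _ hE)
    have hE0 : 0 ≤ E := (abs_nonneg _).trans h4
    have h5 : |τ * γ * ∫ s', ∫ a, u (s', a) ∂(π.kernel s') ∂(M.P x)| ≤ τ * E := by
      rw [abs_mul, abs_of_nonneg (mul_nonneg hτ h0), mul_assoc]
      refine mul_le_mul_of_nonneg_left ?_ hτ
      exact (mul_le_of_le_one_left (abs_nonneg _) h1.le).trans h4
    have h6 := (abs_add_le _ _).trans (add_le_add (hC x) h5)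
    exact mul_le_mul h6 (abs_qLin_le hφ θ x) (abs_nonneg _) ((abs_nonneg _).trans h6)
  linarith [le_abs_self (∫ x, (M.c x + τ * γ * ∫ s', ∫ a, u (s', a) ∂(π.kernel s') ∂(M.P x))
    * qLin φ θ x ∂(stateActionOccupancy M γ π β))]

/-! ### Dependence of the value function on the policy -/

theorem abs_le_of_self_bound {X : Type*} {f : X → ℝ} {a γ : ℝ} (hγ : γ < 1) {C : ℝ}
    (hC : ∀ x, |f x| ≤ C) (h : ∀ D, (∀ x, |f x| ≤ D) → ∀ x, |f x| ≤ a + γ * D) (x : X) :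
    |f x| ≤ (1 - γ)⁻¹ * a := by
  have hbd : BddAbove (Set.range fun x => |f x|) := ⟨C, by rintro _ ⟨y, rfl⟩; exact hC y⟩
  have : Nonempty X := ⟨x⟩
  have h1 : ∀ y, |f y| ≤ ⨆ z, |f z| := fun y => le_ciSup hbd y
  have h2 : ⨆ z, |f z| ≤ a + γ * ⨆ z, |f z| := ciSup_le (h _ h1)
  refine (h1 x).trans ?_
  rw [inv_mul_eq_div, le_div_iff₀ (by linarith)]
  linarith

theorem abs_regCost_le {C E : ℝ} (hτ : 0 ≤ τ) (hτ1 : τ ≤ 1) (hC : ∀ x, |M.c x| ≤ C)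
    (hu : IsLogDensity M.μ π u) (hE : ∀ s, |∫ a, u (s, a) ∂(π.kernel s)| ≤ E) (s : S) :
    |regCost M τ π u s| ≤ C + E := by
  rw [regCost_eq hu]
  refine (abs_add_le _ _).trans (add_le_add (abs_integral_le_of_ae (ae_of_all _ fun a => hC _)) ?_)
  rw [abs_mul, abs_of_nonneg hτ]
  exact (mul_le_of_le_one_left (abs_nonneg _) hτ1).trans (hE s)

theorem abs_regValue_le {C E : ℝ} (h0 : 0 ≤ γ) (h1 : γ < 1) (hτ : 0 ≤ τ) (hτ1 : τ ≤ 1)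
    (hC : ∀ x, |M.c x| ≤ C) (hu : IsLogDensity M.μ π u)
    (hE : ∀ s, |∫ a, u (s, a) ∂(π.kernel s)| ≤ E) (s : S) :
    |regValue M γ τ π u s| ≤ (1 - γ)⁻¹ * (C + E) := by
  have := isMarkovKernel_occupancy h0 h1 (stateKernel M π)
  rw [regValue, abs_mul, abs_of_nonneg (inv_nonneg.2 (by linarith))]
  exact mul_le_mul_of_nonneg_left
    (abs_integral_le_of_ae (ae_of_all _ (abs_regCost_le hτ hτ1 hC hu hE)))
    (inv_nonneg.2 (by linarith))

variable [MeasurableSpace.CountableOrCountablyGenerated S A]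

theorem abs_qFun_le {C E : ℝ} (h0 : 0 ≤ γ) (h1 : γ < 1) (hτ : 0 ≤ τ) (hτ1 : τ ≤ 1)
    (hC : ∀ x, |M.c x| ≤ C) (hu : IsLogDensity M.μ π u)
    (hE : ∀ s, |∫ a, u (s, a) ∂(π.kernel s)| ≤ E) (x : S × A) :
    |qFun M γ τ π x| ≤ (1 - γ)⁻¹ * (C + E) := by
  have hV := abs_regValue_le h0 h1 hτ hτ1 hC hu hE
  have h2 : |∫ s', regValue M γ τ π u s' ∂(M.P x)| ≤ (1 - γ)⁻¹ * (C + E) :=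
    abs_integral_le_of_ae (ae_of_all _ hV)
  have hE0 : 0 ≤ E := (abs_nonneg _).trans (hE x.1)
  have hne : 1 - γ ≠ 0 := by linarith
  rw [qFun_eq h0 h1 hτ hu]
  refine (abs_add_le _ _).trans ?_
  rw [abs_mul, abs_of_nonneg h0]
  calc |M.c x| + γ * |∫ s', regValue M γ τ π u s' ∂(M.P x)|
      ≤ (C + E) + γ * ((1 - γ)⁻¹ * (C + E)) :=
        add_le_add ((hC x).trans (by linarith)) (mul_le_mul_of_nonneg_left h2 h0)
    _ = (1 - γ)⁻¹ * (C + E) := by field_simp; ring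

/-- The regularised value function is Lipschitz in the logarithmic density of the policy. -/
theorem abs_regValue_sub_le {π' : Policy S A} {v : S × A → ℝ} {C W δ : ℝ} (h0 : 0 ≤ γ)
    (h1 : γ < 1) (hτ : 0 ≤ τ) (hτ1 : τ ≤ 1) (hC : ∀ x, |M.c x| ≤ C)
    (hu : IsLogDensity M.μ π u) (hv : IsLogDensity M.μ π' v)
    (huW : ∀ s, ∀ᵐ a ∂M.μ, |u (s, a)| ≤ W) (hvW : ∀ s, ∀ᵐ a ∂M.μ, |v (s, a)| ≤ W)
    (hδ : ∀ s, ∀ᵐ a ∂M.μ, |u (s, a) - v (s, a)| ≤ δ) (s : S) :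
    |regValue M γ τ π u s - regValue M γ τ π' v s|
      ≤ (1 - γ)⁻¹ * (2 * ((1 - γ)⁻¹ * (C + W)) * δ + (1 + 2 * W) * δ) := by
  have hE : ∀ s, |∫ a, u (s, a) ∂(π.kernel s)| ≤ W := fun s =>
    abs_integral_le_of_ae (gibbs_ae_of_ae (hu.2 s) (huW s))
  obtain ⟨B, hB⟩ := ((isBdd_regValue (τ := τ) h0 h1 hu).sub
    (isBdd_regValue (τ := τ) h0 h1 hv)).2
  refine abs_le_of_self_bound h1 hB (fun D hD s => ?_) s
  have hq := isBdd_qFun h0 h1 hτ hu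
  have hq' := isBdd_qFun h0 h1 hτ hv
  have hqs : IsBddMeasurable fun a => qFun M γ τ π (s, a) := hq.comp measurable_prodMk_left
  have hqs' : IsBddMeasurable fun a => qFun M γ τ π' (s, a) := hq'.comp measurable_prodMk_left
  have ha := abs_integral_gibbs_sub_le (hu.section_bdd s) (hv.section_bdd s) (hu.2 s) (hv.2 s)
    (hδ s) hqs (ae_of_all _ fun a => abs_qFun_le h0 h1 hτ hτ1 hC hu hE (s, a))
  have hb := abs_entropy_gibbs_sub_le (hu.section_bdd s) (hv.section_bdd s) (hu.2 s) (hv.2 s)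
    (hδ s) (hvW s)
  have hc : |∫ a, (qFun M γ τ π (s, a) - qFun M γ τ π' (s, a)) ∂(π'.kernel s)| ≤ γ * D := by
    refine abs_integral_le_of_ae (ae_of_all _ fun a => ?_)
    rw [qFun_eq h0 h1 hτ hu, qFun_eq h0 h1 hτ hv, add_sub_add_left_eq_sub, ← mul_sub,
      ← integral_sub ((isBdd_regValue h0 h1 hu).integrable _)
        ((isBdd_regValue h0 h1 hv).integrable _), abs_mul, abs_of_nonneg h0]
    exact mul_le_mul_of_nonneg_left (abs_integral_le_of_ae (ae_of_all _ hD)) h0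
  rw [integral_sub (hqs.integrable _) (hqs'.integrable _)] at hc
  have hb' : |τ * (∫ a, u (s, a) ∂(π.kernel s) - ∫ a, v (s, a) ∂(π'.kernel s))|
      ≤ (1 + 2 * W) * δ := by
    rw [abs_mul, abs_of_nonneg hτ]
    exact (mul_le_of_le_one_left (abs_nonneg _) hτ1).trans hb
  rw [regValue_eq_integral_qFun h0 h1 hτ hu, regValue_eq_integral_qFun h0 h1 hτ hv]
  rw [abs_le] at ha hb' hc ⊢
  constructor <;> linarith

end Critic

/-! ### A comparison principle -/

section Barrier

open Set Filter Topology

/-- If `f` starts below the barrier `B` and cannot cross it at a first contact time, it stays below.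
At a contact time the whole past `f ≤ B` is available. -/
theorem le_of_barrier {f B : ℝ → ℝ} {T : ℝ} (hf : ContinuousOn f (Icc 0 T))
    (hB : ContinuousOn B (Icc 0 T)) (h0 : f 0 ≤ B 0)
    (hstep : ∀ t ∈ Ico 0 T, (∀ r ∈ Icc 0 t, f r ≤ B r) → f t = B t →
      ∀ᶠ z in 𝓝[>] t, f z ≤ B z) :
    ∀ t ∈ Icc 0 T, f t ≤ B t := by
  by_contra! hcon
  obtain ⟨t₁, ht₁, hlt⟩ := hcon
  set E := {t | t ∈ Icc 0 T ∧ B t < f t} with hE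
  have hne : E.Nonempty := ⟨t₁, ht₁, hlt⟩
  have hbd : BddBelow E := ⟨0, fun t ht => ht.1.1⟩
  set a := sInf E with ha
  have ha0 : 0 ≤ a := le_csInf hne fun t ht => ht.1.1
  have hat₁ : a ≤ t₁ := csInf_le hbd ⟨ht₁, hlt⟩
  have hbefore : ∀ r ∈ Ico 0 a, f r ≤ B r := fun r hr => by
    by_contra! h
    exact absurd (csInf_le hbd ⟨⟨hr.1, hr.2.le.trans (hat₁.trans ht₁.2)⟩, h⟩) (not_le.2 hr.2)
  have hsub : Icc 0 a ⊆ Icc 0 T := Icc_subset_Icc_right (hat₁.trans ht₁.2)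
  have haB : f a ≤ B a := by
    rcases ha0.eq_or_lt with h | h
    · rw [← h]; exact h0
    · have hcl : closure (Ico 0 a) = Icc 0 a := closure_Ico h.ne
      exact le_on_closure hbefore (hcl ▸ hf.mono hsub) (hcl ▸ hB.mono hsub)
        (hcl ▸ right_mem_Icc.2 ha0)
  have hlt₁ : a < t₁ := lt_of_le_of_ne hat₁ fun h => absurd haB (not_le.2 (h ▸ hlt))
  have haT : a < T := hlt₁.trans_le ht₁.2
  have hev : ∀ᶠ z in 𝓝[>] a, f z ≤ B z := by
    rcases haB.eq_or_lt with h | h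
    · refine hstep a ⟨ha0, haT⟩ (fun r hr => ?_) h
      rcases hr.2.eq_or_lt with h' | h'
      · rw [h']; exact haB
      · exact hbefore r ⟨hr.1, h'⟩
    · have hmem : Icc 0 T ∈ 𝓝[>] a :=
        mem_of_superset (Ioc_mem_nhdsGT haT) fun z hz => ⟨ha0.trans hz.1.le, hz.2⟩
      have h1 : Tendsto f (𝓝[>] a) (𝓝 (f a)) :=
        (hf a ⟨ha0, haT.le⟩).mono_left (nhdsWithin_le_of_mem hmem)
      have h2 : Tendsto B (𝓝[>] a) (𝓝 (B a)) :=
        (hB a ⟨ha0, haT.le⟩).mono_left (nhdsWithin_le_of_mem hmem)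
      exact (h1.eventually_lt h2 h).mono fun z hz => hz.le
  obtain ⟨b, hb, hb'⟩ := (mem_nhdsGT_iff_exists_Ioo_subset).1 hev
  obtain ⟨e, he, heb⟩ := exists_lt_of_csInf_lt hne (show sInf E < b from hb)
  have hae : a < e := lt_of_le_of_ne (csInf_le hbd he) fun h => absurd haB (not_le.2 (h ▸ he.2))
  exact absurd (hb' ⟨hae, heb⟩) (not_le.2 he.2)

theorem eventually_le_of_deriv_lt {f B : ℝ → ℝ} {f' B' t : ℝ}
    (hf : HasDerivWithinAt f f' (Ici t) t) (hB : HasDerivWithinAt B B' (Ici t) t)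
    (h : f t ≤ B t) (hlt : f' < B') : ∀ᶠ z in 𝓝[>] t, f z ≤ B z := by
  have h1 := (hB.sub hf).Ioi_of_Ici
  rw [hasDerivWithinAt_iff_tendsto_slope' self_notMem_Ioi] at h1
  filter_upwards [h1.eventually (lt_mem_nhds (sub_pos.2 hlt)), self_mem_nhdsWithin] with z hz hzt
  rw [slope_def_field, div_pos_iff_of_pos_right (sub_pos.2 hzt)] at hz
  simp only [Pi.sub_apply] at hz
  linarith

theorem hasDerivWithinAt_const_mul_exp (D k t : ℝ) :
    HasDerivWithinAt (fun r => D * Real.exp (k * r)) (D * (Real.exp (k * t) * k)) (Ici t) t := by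
  have := (((hasDerivAt_id t).const_mul k).exp.const_mul D).hasDerivWithinAt (s := Ici t)
  simpa using this

theorem continuousOn_of_dist_le {E : Type*} [PseudoMetricSpace E] {f : ℝ → E} {K T : ℝ}
    (hK : 0 ≤ K)
    (h : ∀ t ∈ Icc 0 T, ∀ z ∈ Icc 0 T, t ≤ z → dist (f z) (f t) ≤ K * (z - t)) :
    ContinuousOn f (Icc 0 T) := by
  refine (LipschitzOnWith.of_dist_le_mul (K := ⟨K, hK⟩) fun z hz y hy => ?_).continuousOn
  change _ ≤ K * dist z y
  rcases le_total y z with hyz | hyz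
  · rw [Real.dist_eq, abs_of_nonneg (sub_nonneg.2 hyz)]
    exact h y hy z hz hyz
  · rw [dist_comm, dist_comm z, Real.dist_eq, abs_of_nonneg (sub_nonneg.2 hyz)]
    exact h z hz y hy hyz

end Barrier

/-! ### A priori bounds along the flow -/

section Flow

open Set Filter Topology

variable {S A : Type*} [MeasurableSpace S] [MeasurableSpace A] {N : ℕ}

/-- The standing hypotheses on a trajectory `(π_t, θ_t)` of the flow with log-densities `u_t`, time
scale `η`, cost bound `C` and initial log-density bound `U`. Since `u_0` is determined by `π_0` only
up to `μ`-null sets, the bound `U` holds only `μ`-almost everywhere, for every state. -/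
structure FlowHyp (M : MDP S A) (γ τ : ℝ) (φ : S × A → EuclideanSpace ℝ (Fin N))
    (β : Measure (S × A)) (η : ℝ → ℝ) (π : ℝ → Policy S A) (θ : ℝ → EuclideanSpace ℝ (Fin N))
    (u : ℝ → S × A → ℝ) (C U : ℝ) : Prop where
  γ_nonneg : 0 ≤ γ
  γ_lt : γ < 1
  τ_pos : 0 < τ
  τ_lt : τ < 1
  φ_meas : Measurable φ
  φ_le : ∀ x, ‖φ x‖ ≤ 1
  cost_le : ∀ x, |M.c x| ≤ C
  C_nonneg : 0 ≤ C
  U_nonneg : 0 ≤ U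
  η_nonneg : ∀ t, 0 ≤ t → 0 ≤ η t
  deriv_θ : ∀ t, 0 ≤ t →
    HasDerivWithinAt θ (-(η t • semiGrad M γ τ φ β (θ t) (π t))) (Ici 0) t
  logDensity : ∀ t, 0 ≤ t → IsLogDensity M.μ (π t) (u t)
  deriv_exp : ∀ t, 0 ≤ t → ∀ s a, HasDerivWithinAt (fun r => Real.exp (u r (s, a)))
    (-approxAdvantage τ φ (θ t) (π t) (u t) s a * Real.exp (u t (s, a))) (Ici 0) t
  init : ∀ s, ∀ᵐ a ∂M.μ, |u 0 (s, a)| ≤ U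

namespace FlowHyp

variable {M : MDP S A} {γ τ : ℝ} {φ : S × A → EuclideanSpace ℝ (Fin N)} {β : Measure (S × A)}
  {η : ℝ → ℝ} {π : ℝ → Policy S A} {θ : ℝ → EuclideanSpace ℝ (Fin N)} {u : ℝ → S × A → ℝ}
  {C U R c W : ℝ}

theorem τ_le (h : FlowHyp M γ τ φ β η π θ u C U) : τ ≤ 1 := h.τ_lt.le

theorem deriv_u (h : FlowHyp M γ τ φ β η π θ u C U) {t : ℝ} (ht : 0 ≤ t) (s : S) (a : A) :
    HasDerivWithinAt (fun r => u r (s, a)) (-approxAdvantage τ φ (θ t) (π t) (u t) s a)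
      (Ici 0) t := by
  have h1 := (h.deriv_exp t ht s a).log (Real.exp_pos _).ne'
  simp only [Real.log_exp] at h1
  rwa [mul_div_cancel_right₀ _ (Real.exp_pos _).ne'] at h1

theorem continuousOn_u (h : FlowHyp M γ τ φ β η π θ u C U) (s : S) (a : A) :
    ContinuousOn (fun r => u r (s, a)) (Ici 0) :=
  fun _ ht => (h.deriv_u ht s a).continuousWithinAt

theorem continuousOn_θ (h : FlowHyp M γ τ φ β η π θ u C U) : ContinuousOn θ (Ici 0) :=
  fun t ht => (h.deriv_θ t ht).continuousWithinAt

/-- The difference of log-densities at two actions solves a damped linear equation driven by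
`Q(·; θ_t)`: the normalising integral cancels. -/
theorem sub_le (h : FlowHyp M γ τ φ β η π θ u C U) (hR : 0 < R) (hc : 0 < c)
    (hW : W = 2 * U + 2 * R / c) {T : ℝ} (hθ : ∀ r ∈ Icc 0 T, ‖θ r‖ ≤ R * Real.exp (c * r))
    {s : S} {a b : A} (ha : |u 0 (s, a)| ≤ U) (hb : |u 0 (s, b)| ≤ U) :
    ∀ t ∈ Icc 0 T, u t (s, a) - u t (s, b) ≤ W * Real.exp (c * t) := by
  have hsub : Icc 0 T ⊆ Ici 0 := fun r hr => hr.1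
  have hRc : 0 < 2 * R / c := by positivity
  have hWpos : 0 < W := by linarith [h.U_nonneg]
  refine le_of_barrier (((h.continuousOn_u s a).sub (h.continuousOn_u s b)).mono hsub)
    (by fun_prop) ?_ fun t ht _ heq => ?_
  · rw [abs_le] at ha hb
    simp only [mul_zero, Real.exp_zero, mul_one]
    linarith
  · have hd : HasDerivWithinAt (fun r => u r (s, a) - u r (s, b)) _ (Ici t) t :=
      ((h.deriv_u ht.1 s a).sub (h.deriv_u ht.1 s b)).mono (Ici_subset_Ici.2 ht.1)
    have hdB := hasDerivWithinAt_const_mul_exp W c t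
    refine eventually_le_of_deriv_lt hd hdB heq.le ?_
    have hq1 := abs_le.1 ((abs_qLin_le h.φ_le (θ t) (s, a)).trans (hθ t ⟨ht.1, ht.2.le⟩))
    have hq2 := abs_le.1 ((abs_qLin_le h.φ_le (θ t) (s, b)).trans (hθ t ⟨ht.1, ht.2.le⟩))
    have hWc : W * c = 2 * U * c + 2 * R := by rw [hW]; field_simp
    have hexp := Real.exp_pos (c * t)
    have h1 : 0 < τ * (W * Real.exp (c * t)) := mul_pos h.τ_pos (mul_pos hWpos hexp)
    have h2 : 0 ≤ U * c * Real.exp (c * t) :=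
      mul_nonneg (mul_nonneg h.U_nonneg hc.le) hexp.le
    have h3 : W * (Real.exp (c * t) * c) = (2 * U * c + 2 * R) * Real.exp (c * t) := by
      rw [← hWc]; ring
    rw [← heq] at h1
    simp only [approxAdvantage]
    rw [h3]
    linarith

theorem abs_u_le (h : FlowHyp M γ τ φ β η π θ u C U) (hR : 0 < R) (hc : 0 < c)
    (hW : W = 2 * U + 2 * R / c) {T : ℝ} (hθ : ∀ r ∈ Icc 0 T, ‖θ r‖ ≤ R * Real.exp (c * r))
    {s : S} {a : A} (ha : |u 0 (s, a)| ≤ U) {t : ℝ} (ht : t ∈ Icc 0 T) :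
    |u t (s, a)| ≤ W * Real.exp (c * t) := by
  have hl := h.logDensity t ht.1
  refine abs_le_of_osc_le (hl.section_bdd s) (hl.2 s) (x := a) ?_
  filter_upwards [h.init s] with b hb
  have h1 := h.sub_le hR hc hW hθ ha hb t ht
  have h2 := h.sub_le hR hc hW hθ hb ha t ht
  rw [abs_le]
  constructor <;> linarith

theorem ae_abs_u_le (h : FlowHyp M γ τ φ β η π θ u C U) (hR : 0 < R) (hc : 0 < c)
    (hW : W = 2 * U + 2 * R / c) {T : ℝ} (hθ : ∀ r ∈ Icc 0 T, ‖θ r‖ ≤ R * Real.exp (c * r))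
    (s : S) {t : ℝ} (ht : t ∈ Icc 0 T) :
    ∀ᵐ a ∂M.μ, |u t (s, a)| ≤ W * Real.exp (c * t) := by
  filter_upwards [h.init s] with a ha
  exact h.abs_u_le hR hc hW hθ ha ht

/-- The critic grows at most exponentially, at a rate that does not depend on the time scale `η`:
a faster critic only follows its quasi-stationary state more closely, and that state is controlled
by the entropy of the current policy. -/
theorem norm_θ_le [IsProbabilityMeasure β] (h : FlowHyp M γ τ φ β η π θ u C U) (hR : 0 < R)
    (hc : 0 < c) (hW : W = 2 * U + 2 * R / c) (hstart : ‖θ 0‖ ≤ R)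
    (hΓ : C + W ≤ bigGamma γ φ β * R) {t : ℝ} (ht : 0 ≤ t) :
    ‖θ t‖ ≤ R * Real.exp (c * t) := by
  have key : ∀ r ∈ Icc 0 t, ‖θ r‖ ^ 2 ≤ R ^ 2 * Real.exp (2 * c * r) := by
    refine le_of_barrier ((h.continuousOn_θ.norm.pow 2).mono fun r hr => hr.1) (by fun_prop) ?_
      fun r hr hpast heq => ?_
    · simpa using pow_le_pow_left₀ (norm_nonneg _) hstart 2
    · have hpast' : ∀ z ∈ Icc 0 r, ‖θ z‖ ≤ R * Real.exp (c * z) := fun z hz => by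
        refine le_of_sq_le_sq ((hpast z hz).trans (le_of_eq ?_)) (by positivity)
        rw [mul_pow, ← Real.exp_nat_mul]
        push_cast
        ring_nf
      have hnorm : ‖θ r‖ = R * Real.exp (c * r) := by
        refine (sq_eq_sq₀ (norm_nonneg _) (by positivity)).1 ?_
        rw [heq, mul_pow, ← Real.exp_nat_mul]
        push_cast
        ring_nf
      have hd := ((h.deriv_θ r hr.1).norm_sq).mono (Ici_subset_Ici.2 hr.1)
      refine eventually_le_of_deriv_lt hd (hasDerivWithinAt_const_mul_exp _ _ _) heq.le ?_
      have hl := h.logDensity r hr.1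
      have hE : ∀ s, |∫ a, u r (s, a) ∂((π r).kernel s)| ≤ W * Real.exp (c * r) := fun s =>
        abs_integral_le_of_ae (gibbs_ae_of_ae (hl.2 s)
          (h.ae_abs_u_le hR hc hW hpast' s ⟨hr.1, le_rfl⟩))
      have hg := inner_semiGrad_self_ge h.φ_meas h.φ_le h.γ_nonneg h.γ_lt h.τ_pos.le β hl
        h.cost_le hE (θ r)
      rw [inner_neg_right, inner_smul_right]
      have hexp1 : 1 ≤ Real.exp (c * r) := Real.one_le_exp (mul_nonneg hc.le hr.1)
      have hW0 : 0 ≤ W := by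
        rw [hW]; have := h.U_nonneg; positivity
      have hb : C + τ * (W * Real.exp (c * r)) ≤ (C + W) * Real.exp (c * r) := by
        have h1 : C ≤ C * Real.exp (c * r) := le_mul_of_one_le_right h.C_nonneg hexp1
        have h2 : τ * (W * Real.exp (c * r)) ≤ W * Real.exp (c * r) :=
          mul_le_of_le_one_left (by positivity) h.τ_le
        linarith
      have hpos : 0 ≤ inner ℝ (θ r) (semiGrad M γ τ φ β (θ r) (π r)) := by
        refine le_trans ?_ hg
        rw [hnorm]
        have h3 : (C + τ * (W * Real.exp (c * r))) * (R * Real.exp (c * r))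
            ≤ bigGamma γ φ β * R * Real.exp (c * r) * (R * Real.exp (c * r)) :=
          mul_le_mul_of_nonneg_right (hb.trans (mul_le_mul_of_nonneg_right hΓ (by positivity)))
            (by positivity)
        linarith
      have h4 : 0 ≤ η r * inner ℝ (θ r) (semiGrad M γ τ φ β (θ r) (π r)) :=
        mul_nonneg (h.η_nonneg r hr.1) hpos
      have h5 : 0 < R ^ 2 * (Real.exp (2 * c * r) * (2 * c)) := by positivity
      linarith
  have h1 := key t ⟨ht, le_rfl⟩
  refine le_of_sq_le_sq (h1.trans (le_of_eq ?_)) (by positivity)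
  rw [mul_pow, ← Real.exp_nat_mul]
  push_cast
  ring_nf

/-! ### Regularity of the policies in time -/

theorem abs_advantage_le (h : FlowHyp M γ τ φ β η π θ u C U) (hR : 0 < R) (hc : 0 < c)
    (hW : W = 2 * U + 2 * R / c) (hθ : ∀ t, 0 ≤ t → ‖θ t‖ ≤ R * Real.exp (c * t))
    {s : S} {a : A} (ha : |u 0 (s, a)| ≤ U) {t : ℝ} (ht : 0 ≤ t) :
    |approxAdvantage τ φ (θ t) (π t) (u t) s a| ≤ (2 * R + 2 * W) * Real.exp (c * t) := by
  have hθ' : ∀ r ∈ Icc 0 t, ‖θ r‖ ≤ R * Real.exp (c * r) := fun r hr => hθ r hr.1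
  have hpt : ∀ b, |u 0 (s, b)| ≤ U →
      |qLin φ (θ t) (s, b) + τ * u t (s, b)| ≤ (R + W) * Real.exp (c * t) := fun b hb => by
    have h1 := (abs_qLin_le h.φ_le (θ t) (s, b)).trans (hθ t ht)
    have h2 := h.abs_u_le hR hc hW hθ' hb ⟨ht, le_rfl⟩
    refine (abs_add_le _ _).trans ?_
    rw [abs_mul, abs_of_pos h.τ_pos]
    have h3 : τ * |u t (s, b)| ≤ |u t (s, b)| := mul_le_of_le_one_left (abs_nonneg _) h.τ_le
    linarith
  have hint : |∫ b, (qLin φ (θ t) (s, b) + τ * u t (s, b)) ∂((π t).kernel s)|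
      ≤ (R + W) * Real.exp (c * t) :=
    abs_integral_le_of_ae (gibbs_ae_of_ae ((h.logDensity t ht).2 s) ((h.init s).mono hpt))
  rw [approxAdvantage]
  refine (abs_sub _ _).trans ?_
  linarith [hpt a ha]

theorem abs_u_sub_le (h : FlowHyp M γ τ φ β η π θ u C U) (hR : 0 < R) (hc : 0 < c)
    (hW : W = 2 * U + 2 * R / c) (hθ : ∀ t, 0 ≤ t → ‖θ t‖ ≤ R * Real.exp (c * t))
    {s : S} {a : A} (ha : |u 0 (s, a)| ≤ U) {t z : ℝ} (ht : 0 ≤ t) (htz : t ≤ z) :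
    |u z (s, a) - u t (s, a)| ≤ (2 * R + 2 * W) * Real.exp (c * z) * (z - t) := by
  have hW0 : 0 ≤ W := by rw [hW]; have := h.U_nonneg; positivity
  have h1 := Convex.norm_image_sub_le_of_norm_hasDerivWithin_le (𝕜 := ℝ)
    (f := fun r => u r (s, a)) (s := Icc t z) (x := t) (y := z)
    (f' := fun r => -approxAdvantage τ φ (θ r) (π r) (u r) s a)
    (C := (2 * R + 2 * W) * Real.exp (c * z))
    (fun r hr => (h.deriv_u (ht.trans hr.1) s a).mono fun q hq => ht.trans hq.1)
    (fun r hr => by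
      rw [norm_neg]
      refine (h.abs_advantage_le hR hc hW hθ ha (ht.trans hr.1)).trans ?_
      refine mul_le_mul_of_nonneg_left (Real.exp_le_exp.2 ?_) (by positivity)
      exact mul_le_mul_of_nonneg_left hr.2 hc.le)
    (convex_Icc t z) (left_mem_Icc.2 htz) (right_mem_Icc.2 htz)
  simpa [abs_of_nonneg (sub_nonneg.2 htz)] using h1

/-- A rate `L` for which `e^{2cz} L` is a Lipschitz constant of the value functions up to
time `z`. -/
noncomputable def lipRate (H C R W : ℝ) : ℝ :=
  H * (2 * (H * (C + W)) + (1 + 2 * W)) * (2 * R + 2 * W)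

theorem abs_regValue_sub_le [MeasurableSpace.CountableOrCountablyGenerated S A]
    (h : FlowHyp M γ τ φ β η π θ u C U) (hR : 0 < R)
    (hc : 0 < c) (hW : W = 2 * U + 2 * R / c) (hθ : ∀ t, 0 ≤ t → ‖θ t‖ ≤ R * Real.exp (c * t))
    {H : ℝ} (hH : (1 - γ)⁻¹ ≤ H) {t z : ℝ} (ht : 0 ≤ t) (htz : t ≤ z) (s : S) :
    |regValue M γ τ (π z) (u z) s - regValue M γ τ (π t) (u t) s|
      ≤ lipRate H C R W * Real.exp (2 * c * z) * (z - t) := by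
  have hW0 : 0 ≤ W := by rw [hW]; have := h.U_nonneg; positivity
  have hC0 := h.C_nonneg
  have hz : 0 ≤ z := ht.trans htz
  have hγ : 0 < (1 - γ)⁻¹ := inv_pos.2 (by linarith [h.γ_lt])
  have hexp1 : 1 ≤ Real.exp (c * z) := Real.one_le_exp (mul_nonneg hc.le hz)
  have hexpt : Real.exp (c * t) ≤ Real.exp (c * z) :=
    Real.exp_le_exp.2 (mul_le_mul_of_nonneg_left htz hc.le)
  set δ := (2 * R + 2 * W) * Real.exp (c * z) * (z - t) with hδ
  have hδ0 : 0 ≤ δ := mul_nonneg (by positivity) (sub_nonneg.2 htz)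
  have h1 := ActorCritic.abs_regValue_sub_le h.γ_nonneg h.γ_lt h.τ_pos.le h.τ_le h.cost_le
    (h.logDensity z hz) (h.logDensity t ht) (W := W * Real.exp (c * z)) (δ := δ)
    (fun s => h.ae_abs_u_le hR hc hW (fun r hr => hθ r hr.1) s ⟨hz, le_rfl⟩)
    (fun s => by
      filter_upwards [h.ae_abs_u_le hR hc hW (fun r hr => hθ r hr.1) s ⟨ht, le_rfl⟩] with a ha
      exact ha.trans (mul_le_mul_of_nonneg_left hexpt hW0))
    (fun s => by
      filter_upwards [h.init s] with a ha
      exact h.abs_u_sub_le hR hc hW hθ ha ht htz) s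
  refine h1.trans ?_
  have hCW : C + W * Real.exp (c * z) ≤ (C + W) * Real.exp (c * z) := by
    have := le_mul_of_one_le_right hC0 hexp1
    linarith
  have h2 : (1 - γ)⁻¹ * (C + W * Real.exp (c * z)) ≤ H * ((C + W) * Real.exp (c * z)) :=
    mul_le_mul hH hCW (by positivity) (hγ.le.trans hH)
  have h3 : 1 + 2 * (W * Real.exp (c * z)) ≤ (1 + 2 * W) * Real.exp (c * z) := by linarith
  have h4 : 2 * ((1 - γ)⁻¹ * (C + W * Real.exp (c * z))) * δ + (1 + 2 * (W * Real.exp (c * z))) * δ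
      ≤ (2 * (H * (C + W)) + (1 + 2 * W)) * Real.exp (c * z) * δ := by
    have h5 := mul_le_mul_of_nonneg_right h2 hδ0
    have h6 := mul_le_mul_of_nonneg_right h3 hδ0
    linarith
  have h7 : Real.exp (2 * c * z) = Real.exp (c * z) * Real.exp (c * z) := by
    rw [← Real.exp_add]; ring_nf
  calc (1 - γ)⁻¹ * (2 * ((1 - γ)⁻¹ * (C + W * Real.exp (c * z))) * δ
        + (1 + 2 * (W * Real.exp (c * z))) * δ)
      ≤ H * ((2 * (H * (C + W)) + (1 + 2 * W)) * Real.exp (c * z) * δ) :=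
        mul_le_mul hH h4 (by positivity) (hγ.le.trans hH)
    _ = lipRate H C R W * Real.exp (2 * c * z) * (z - t) := by
        rw [h7, hδ, lipRate]; ring

theorem admissible (h : FlowHyp M γ τ φ β η π θ u C U) {t : ℝ} (ht : 0 ≤ t) :
    (π t).Admissible M.μ :=
  have hl := h.logDensity t ht
  ⟨u t, hl.1, fun s => withDensity_exp_eq_tilted (hl.section_bdd s) (hl.2 s)⟩

/-! ### Tracking of the moving target by the critic -/

variable {F : ℝ → EuclideanSpace ℝ (Fin N)} {H : ℝ}

theorem norm_target_sub_le [MeasurableSpace.CountableOrCountablyGenerated S A]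
    [IsProbabilityMeasure β]
    (h : FlowHyp M γ τ φ β η π θ u C U) (hR : 0 < R)
    (hc : 0 < c) (hW : W = 2 * U + 2 * R / c) (hθ : ∀ t, 0 ≤ t → ‖θ t‖ ≤ R * Real.exp (c * t))
    (hH : (1 - γ)⁻¹ ≤ H) (hβ : 0 < lambdaBeta φ β)
    (hF : ∀ t, 0 ≤ t → ∀ x, qFun M γ τ (π t) x = qLin φ (F t) x)
    {t z : ℝ} (ht : 0 ≤ t) (htz : t ≤ z) :
    ‖F z - F t‖
      ≤ (lambdaBeta φ β)⁻¹ * lipRate H C R W * Real.exp (2 * c * z) * (z - t) := by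
  have hz : 0 ≤ z := ht.trans htz
  have hV := h.abs_regValue_sub_le hR hc hW hθ hH ht htz
  have hγ0 := h.γ_nonneg
  have hlt := h.logDensity t ht
  have hlz := h.logDensity z hz
  have hb : ∀ x, |qLin φ (F z - F t) x| ≤ lipRate H C R W * Real.exp (2 * c * z) * (z - t) := by
    intro x
    rw [qLin_sub, ← hF z hz, ← hF t ht, qFun_eq hγ0 h.γ_lt h.τ_pos.le hlz,
      qFun_eq hγ0 h.γ_lt h.τ_pos.le hlt, add_sub_add_left_eq_sub, ← mul_sub,
      ← integral_sub ((isBdd_regValue hγ0 h.γ_lt hlz).integrable _)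
        ((isBdd_regValue hγ0 h.γ_lt hlt).integrable _), abs_mul, abs_of_nonneg hγ0]
    exact (mul_le_of_le_one_left (abs_nonneg _) h.γ_lt.le).trans
      (abs_integral_le_of_ae (ae_of_all _ hV))
  obtain ⟨x⟩ := nonempty_of_isProbabilityMeasure β
  have h2 := lambdaBeta_mul_norm_le h.φ_meas h.φ_le β hβ (F z - F t)
    ((abs_nonneg _).trans (hb x)) hb
  rw [mul_assoc, mul_assoc, inv_mul_eq_div, le_div_iff₀ hβ]
  linarith

theorem norm_target_zero_le [MeasurableSpace.CountableOrCountablyGenerated S A]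
    [IsProbabilityMeasure β]
    (h : FlowHyp M γ τ φ β η π θ u C U) (hH : (1 - γ)⁻¹ ≤ H) (hβ : 0 < lambdaBeta φ β)
    (hF : ∀ t, 0 ≤ t → ∀ x, qFun M γ τ (π t) x = qLin φ (F t) x) :
    ‖F 0‖ ≤ (lambdaBeta φ β)⁻¹ * (H * (C + U)) := by
  have hl := h.logDensity 0 le_rfl
  have hCU : 0 ≤ C + U := add_nonneg h.C_nonneg h.U_nonneg
  have hγ : 0 < (1 - γ)⁻¹ := inv_pos.2 (by linarith [h.γ_lt])
  have hE : ∀ s, |∫ a, u 0 (s, a) ∂((π 0).kernel s)| ≤ U := fun s =>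
    abs_integral_le_of_ae (gibbs_ae_of_ae (hl.2 s) (h.init s))
  have hb : ∀ x, |qLin φ (F 0) x| ≤ H * (C + U) := fun x => by
    rw [← hF 0 le_rfl]
    exact (abs_qFun_le h.γ_nonneg h.γ_lt h.τ_pos.le h.τ_le h.cost_le hl hE x).trans
      (mul_le_mul_of_nonneg_right hH hCU)
  have h2 := lambdaBeta_mul_norm_le h.φ_meas h.φ_le β hβ (F 0)
    (mul_nonneg (hγ.le.trans hH) hCU) hb
  rw [inv_mul_eq_div, le_div_iff₀ hβ]
  linarith

/-- With the time scale `η_t = η₀ e^{(2c + 1) t}` the critic error decays exponentially: the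
contraction rate `η_t Γ ≥ e^{(2c + 1) t}` outgrows the speed `O(e^{2ct})` of the target. -/
theorem critic_error_le [MeasurableSpace.CountableOrCountablyGenerated S A]
    [IsProbabilityMeasure β] {η₀ L D : ℝ}
    (h : FlowHyp M γ τ φ β (fun t => η₀ * Real.exp ((2 * c + 1) * t)) π θ u C U) (hc : 0 < c)
    (hF : ∀ t, 0 ≤ t → ∀ x, qFun M γ τ (π t) x = qLin φ (F t) x)
    (hLip : ∀ t z, 0 ≤ t → t ≤ z → ‖F z - F t‖ ≤ L * Real.exp (2 * c * z) * (z - t))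
    (hηΓ : 1 < η₀ * bigGamma γ φ β) (hD : 0 < D) (hD0 : ‖θ 0 - F 0‖ ≤ D) (hDL : 2 * L ≤ D)
    {t : ℝ} (ht : 0 ≤ t) : ‖θ t - F t‖ ≤ D * Real.exp (-(τ / 2) * t) := by
  have hFc : ContinuousOn F (Icc 0 t) :=
    continuousOn_of_dist_le (K := |L| * Real.exp (2 * c * t)) (by positivity)
      fun y hy z hz hyz => by
        rw [dist_eq_norm]
        refine (hLip y z hy.1 hyz).trans (mul_le_mul_of_nonneg_right ?_ (sub_nonneg.2 hyz))
        exact mul_le_mul (le_abs_self L) (Real.exp_le_exp.2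
          (mul_le_mul_of_nonneg_left hz.2 (by positivity))) (Real.exp_pos _).le (abs_nonneg _)
  refine le_of_barrier (T := t) (B := fun r => D * Real.exp (-(τ / 2) * r))
    (((h.continuousOn_θ.mono fun r hr => hr.1).sub hFc).norm)
    (by fun_prop) (by simpa using hD0) (fun r hr _ heq => ?_) t ⟨ht, le_rfl⟩
  -- On `[r, ∞)` the error is at most `‖θ_z - F_r‖ + ‖F_z - F_r‖`, which is differentiable at `r`.
  have hepos : 0 < ‖θ r - F r‖ := by
    have : ‖θ r - F r‖ = D * Real.exp (-(τ / 2) * r) := heq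
    rw [this]; positivity
  have hd1 : HasDerivWithinAt (fun z => θ z - F r) _ (Ici r) r :=
    ((h.deriv_θ r hr.1).mono (Ici_subset_Ici.2 hr.1)).sub_const (F r)
  have hd2 := hd1.norm_sq.sqrt (by positivity)
  have hsq : ∀ z, √(‖θ z - F r‖ ^ 2) = ‖θ z - F r‖ := fun z => Real.sqrt_sq (norm_nonneg _)
  simp only [hsq] at hd2
  have hd3 := (hasDerivWithinAt_const_mul_exp L (2 * c) r).mul
    ((hasDerivWithinAt_id r (Ici r)).sub_const r)
  have hN := hd2.add hd3
  refine (eventually_le_of_deriv_lt hN (hasDerivWithinAt_const_mul_exp D (-(τ / 2)) r) ?_ ?_).mp ?_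
  · simpa using heq.le
  · have hg := inner_semiGrad_sub_ge h.φ_meas h.φ_le h.γ_nonneg h.γ_lt h.τ_pos.le β
      (h.logDensity r hr.1) (θ r) (hF r hr.1)
    have heq' : ‖θ r - F r‖ = D * Real.exp (-(τ / 2) * r) := heq
    set e := ‖θ r - F r‖ with he
    set G := inner ℝ (θ r - F r) (semiGrad M γ τ φ β (θ r) (π r)) with hG
    set X := Real.exp ((2 * c + 1) * r) with hX
    have hX1 : 1 ≤ X := Real.one_le_exp (mul_nonneg (by linarith) hr.1)
    have hη0 : 0 < η₀ := by
      have := h.η_nonneg 0 le_rfl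
      simp only [mul_zero, Real.exp_zero, mul_one] at this
      rcases this.eq_or_lt with h0 | h0
      · rw [← h0] at hηΓ; linarith
      · exact h0
    have h1 : 2 * inner ℝ (θ r - F r) (-((η₀ * X) • semiGrad M γ τ φ β (θ r) (π r))) / (2 * e)
        ≤ -(X * e) := by
      rw [inner_neg_right, inner_smul_right, ← hG, div_le_iff₀ (by positivity)]
      have h2 : η₀ * X * (bigGamma γ φ β * e ^ 2) ≤ η₀ * X * G :=
        mul_le_mul_of_nonneg_left hg (by positivity)
      have h3 : 1 * (X * e ^ 2) ≤ (η₀ * bigGamma γ φ β) * (X * e ^ 2) :=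
        mul_le_mul_of_nonneg_right hηΓ.le (by positivity)
      nlinarith
    have h4 : Real.exp (2 * c * r) ≤ X * Real.exp (-(τ / 2) * r) := by
      rw [hX, ← Real.exp_add]
      refine Real.exp_le_exp.2 ?_
      have := mul_nonneg (by linarith [h.τ_le] : (0 : ℝ) ≤ 1 - τ / 2) hr.1
      linarith
    have h5 : 2 * L * Real.exp (2 * c * r) ≤ X * e := by
      rw [heq']
      calc 2 * L * Real.exp (2 * c * r) ≤ D * Real.exp (2 * c * r) :=
            mul_le_mul_of_nonneg_right hDL (Real.exp_pos _).le
        _ ≤ D * (X * Real.exp (-(τ / 2) * r)) := mul_le_mul_of_nonneg_left h4 hD.le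
        _ = X * (D * Real.exp (-(τ / 2) * r)) := by ring
    have h6 : e ≤ X * e := le_mul_of_one_le_left hepos.le hX1
    have h7 : D * (Real.exp (-(τ / 2) * r) * -(τ / 2)) = -(τ / 2) * e := by rw [heq']; ring
    have h8 : τ / 2 * e < 1 / 2 * e :=
      mul_lt_mul_of_pos_right (by linarith [h.τ_lt]) hepos
    rw [h7]
    simp only [id_eq, sub_self, mul_zero, zero_add, mul_one]
    linarith
  · filter_upwards [self_mem_nhdsWithin] with z hz hle
    have hz' : r ≤ z := le_of_lt hz
    have h1 := norm_add_le (θ z - F r) (F r - F z)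
    rw [sub_add_sub_cancel, norm_sub_rev (F r)] at h1
    refine h1.trans (le_trans (add_le_add_right (hLip r z hr.1 hz') _) ?_)
    simpa using hle

end FlowHyp

end Flow

/-! ### Performance difference -/

section Actor

open Set Filter Topology InformationTheory

variable {S A : Type*} [MeasurableSpace S] [MeasurableSpace A] {N : ℕ}

/-- The joint law of a state drawn from `d` and an action drawn from the policy. -/
noncomputable def jointLaw (d : Measure S) (π : Policy S A) : Measure (S × A) :=
  d.bind (Kernel.id ×ₖ π.kernel)

instance (d : Measure S) [IsProbabilityMeasure d] (π : Policy S A) :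
    IsProbabilityMeasure (jointLaw d π) := by
  unfold jointLaw; infer_instance

theorem integral_jointLaw (d : Measure S) [IsProbabilityMeasure d] (π : Policy S A)
    {f : S × A → ℝ} (hf : IsBddMeasurable f) :
    ∫ x, f x ∂(jointLaw d π) = ∫ s, ∫ a, f (s, a) ∂(π.kernel s) ∂d := by
  rw [jointLaw, hf.integral_bind]
  simp only [hf.integral_id_prod]

theorem ae_jointLaw (d : Measure S) (π : Policy S A) {p : S × A → Prop}
    (hp : MeasurableSet {x | p x}) (h : ∀ᵐ s ∂d, ∀ᵐ a ∂(π.kernel s), p (s, a)) :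
    ∀ᵐ x ∂(jointLaw d π), p x := by
  refine Measure.ae_comp_of_ae_ae hp ?_
  filter_upwards [h] with s hs
  rw [Kernel.prod_apply, Kernel.id_apply, Measure.dirac_prod,
    ae_map_iff measurable_prodMk_left.aemeasurable hp]
  exact hs

variable {M : MDP S A} {γ τ : ℝ} {π πs : Policy S A} {u : S × A → ℝ} {ρ : Measure S}

/-- The Bellman equation of `π`, integrated along the chain of another policy. -/
theorem performance_difference [MeasurableSpace.CountableOrCountablyGenerated S A]
    [IsProbabilityMeasure ρ] (h0 : 0 ≤ γ) (h1 : γ < 1) (hτ : 0 ≤ τ)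
    (hu : IsLogDensity M.μ π u) (πs : Policy S A) :
    ∫ x, qFun M γ τ π x ∂(jointLaw (stateOccupancy M γ πs ρ) πs)
        - ∫ s, regValue M γ τ π u s ∂(stateOccupancy M γ πs ρ)
      = ∫ x, M.c x ∂(jointLaw (stateOccupancy M γ πs ρ) πs)
        - (1 - γ) * ∫ s, regValue M γ τ π u s ∂ρ := by
  have hd : IsProbabilityMeasure (stateOccupancy M γ πs ρ) :=
    isProbabilityMeasure_bind_occupancy h0 h1 _ ρ
  have hV := isBdd_regValue (τ := τ) h0 h1 hu
  have hPV := hV.integral_kernel M.P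
  have hbal := integral_balance (d := stateOccupancy M γ πs ρ) h0 h1
    (m' := (stateOccupancy M γ πs ρ).bind (stateKernel M πs))
    (bind_occupancy_eq h0 (stateKernel M πs) ρ) hV
  rw [hV.integral_bind] at hbal
  simp only [integral_stateKernel hV] at hbal
  rw [← integral_jointLaw _ πs hPV] at hbal
  simp only [qFun_eq h0 h1 hτ hu]
  rw [integral_add (M.isBdd_c.integrable _) ((hPV.const_mul γ).integrable _), integral_const_mul]
  linarith

/-- Integrated form of `klDiv_gibbs_right`. -/
theorem lintegral_klDiv_eq [MeasurableSpace.CountableOrCountablyGenerated S A]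
    (hu : IsLogDensity M.μ π u) (d : Measure S) [IsProbabilityMeasure d]
    (hK : ∫⁻ s, klRef M πs s ∂d ≠ ⊤) :
    Integrable (fun s => (klDiv (πs.kernel s) (π.kernel s)).toReal) d ∧
    ∫⁻ s, klDiv (πs.kernel s) (π.kernel s) ∂d ≠ ⊤ ∧
    ∫ s, (klDiv (πs.kernel s) (π.kernel s)).toReal ∂d
      = (∫⁻ s, klDiv (πs.kernel s) (π.kernel s) ∂d).toReal ∧
    (∫⁻ s, klDiv (πs.kernel s) (π.kernel s) ∂d).toReal
      = (∫⁻ s, klRef M πs s ∂d).toReal - ∫ x, u x ∂(jointLaw d πs) := by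
  have hm := measurable_klRef M πs
  have hfin := ae_lt_top hm hK
  have hm' := measurable_klDiv_kernel πs.kernel π.kernel
  have hkey : ∀ᵐ s ∂d, klDiv (πs.kernel s) (π.kernel s) ≠ ⊤ ∧
      (klDiv (πs.kernel s) (π.kernel s)).toReal
        = (klRef M πs s).toReal - ∫ a, u (s, a) ∂(πs.kernel s) := by
    filter_upwards [hfin] with s hs
    exact klDiv_gibbs_right (hu.section_bdd s) (hu.2 s) hs.ne
  have hki : Integrable (fun s => (klRef M πs s).toReal) d :=
    integrable_toReal_of_lintegral_ne_top hm.aemeasurable hK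
  have hui := (hu.1.integral_prod πs.kernel).integrable d
  have hint : Integrable (fun s => (klDiv (πs.kernel s) (π.kernel s)).toReal) d :=
    (integrable_congr (hkey.mono fun s hs => hs.2)).2 (hki.sub hui)
  have htr : ∫ s, (klDiv (πs.kernel s) (π.kernel s)).toReal ∂d
      = (∫⁻ s, klDiv (πs.kernel s) (π.kernel s) ∂d).toReal :=
    integral_toReal hm'.aemeasurable (hkey.mono fun s hs => hs.1.lt_top)
  refine ⟨hint, ?_, htr, ?_⟩
  · have : ∫⁻ s, klDiv (πs.kernel s) (π.kernel s) ∂d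
        = ∫⁻ s, ENNReal.ofReal (klDiv (πs.kernel s) (π.kernel s)).toReal ∂d :=
      lintegral_congr_ae (hkey.mono fun s hs => (ENNReal.ofReal_toReal hs.1).symm)
    rw [this, ← ofReal_integral_eq_lintegral_ofReal hint
      (ae_of_all _ fun s => ENNReal.toReal_nonneg)]
    exact ENNReal.ofReal_ne_top
  · rw [← htr, integral_congr_ae (hkey.mono fun s hs => hs.2), integral_sub hki hui,
      integral_toReal hm.aemeasurable hfin, integral_jointLaw d πs hu.1]

/-- The finite value of a policy whose occupancy measure has finite mean entropy. -/
theorem valueAt_eq_of_ne_top [MeasurableSpace.CountableOrCountablyGenerated S A]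
    [IsProbabilityMeasure ρ] (h0 : 0 ≤ γ) (h1 : γ < 1) (hτ : 0 ≤ τ)
    (hK : ∫⁻ s, klRef M πs s ∂(stateOccupancy M γ πs ρ) ≠ ⊤) :
    valueAt M γ τ πs ρ = (((1 - γ)⁻¹ * (∫ x, M.c x ∂(jointLaw (stateOccupancy M γ πs ρ) πs)
      + τ * (∫⁻ s, klRef M πs s ∂(stateOccupancy M γ πs ρ)).toReal) : ℝ) : EReal) := by
  have hd : IsProbabilityMeasure (stateOccupancy M γ πs ρ) :=
    isProbabilityMeasure_bind_occupancy h0 h1 _ ρ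
  have hτγ : 0 ≤ τ / (1 - γ) := div_nonneg hτ (by linarith)
  rw [valueAt, lintegral_entropyValue M h1 hτ, integral_costValue M h0 h1,
    integral_jointLaw _ πs M.isBdd_c]
  nth_rewrite 1 [← ENNReal.ofReal_toReal hK]
  rw [← ENNReal.ofReal_mul hτγ, EReal.coe_ennreal_ofReal,
    max_eq_left (mul_nonneg hτγ ENNReal.toReal_nonneg), ← EReal.coe_add]
  congr 1
  rw [div_eq_mul_inv]
  ring

/-- An optimal policy has finite mean entropy, since any Gibbs policy has finite value. -/
theorem IsOptimal.lintegral_klRef_ne_top [MeasurableSpace.CountableOrCountablyGenerated S A]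
    [IsProbabilityMeasure ρ] (h0 : 0 ≤ γ) (h1 : γ < 1) (hτ : 0 < τ)
    (hopt : IsOptimal M γ τ ρ πs) (hu : IsLogDensity M.μ π u) :
    ∫⁻ s, klRef M πs s ∂(stateOccupancy M γ πs ρ) ≠ ⊤ := by
  intro htop
  have hle := hopt π
  rw [valueAt_eq h0 h1 hτ.le hu, valueAt, lintegral_entropyValue M h1 hτ.le, htop,
    ENNReal.mul_top (by simpa using div_pos hτ (by linarith)), EReal.coe_ennreal_top,
    EReal.coe_add_top, top_le_iff] at hle
  exact EReal.coe_ne_top _ hle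

/-! ### Drift of the relative entropy to the optimal policy -/

variable {φ : S × A → EuclideanSpace ℝ (Fin N)} {θ θ' : EuclideanSpace ℝ (Fin N)}

theorem isBdd_approxAdvantage (hm : Measurable φ) (hφ : ∀ x, ‖φ x‖ ≤ 1)
    (hu : IsLogDensity M.μ π u) :
    IsBddMeasurable fun x : S × A => approxAdvantage τ φ θ π u x.1 x.2 := by
  have h := (isBdd_qLin hm hφ θ).add (hu.1.const_mul τ)
  exact h.sub ((h.integral_prod π.kernel).comp measurable_fst)

/-- The mean approximate advantage of `π` under the occupancy measure of `πs`. The error of the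
critic is multiplied by `πs - π` and is absorbed, through Pinsker's inequality, by half of the
relative entropy that regularisation provides. -/
theorem integral_approxAdvantage_le [MeasurableSpace.CountableOrCountablyGenerated S A]
    [IsProbabilityMeasure ρ] (hm : Measurable φ) (hφ : ∀ x, ‖φ x‖ ≤ 1)
    (h0 : 0 ≤ γ) (h1 : γ < 1) (hτ : 0 < τ) (hu : IsLogDensity M.μ π u)
    (hθ' : ∀ x, qFun M γ τ π x = qLin φ θ' x) {ε : ℝ} (hε : ‖θ - θ'‖ ≤ ε)
    {d : Measure S} (hdd : d = stateOccupancy M γ πs ρ)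
    (hK : ∫⁻ s, klRef M πs s ∂d ≠ ⊤) :
    ∫ x, approxAdvantage τ φ θ π u x.1 x.2 ∂(jointLaw d πs)
      ≤ ∫ x, M.c x ∂(jointLaw d πs) + τ * (∫⁻ s, klRef M πs s ∂d).toReal
        - (1 - γ) * ∫ s, regValue M γ τ π u s ∂ρ
        - τ / 2 * (∫⁻ s, klDiv (πs.kernel s) (π.kernel s) ∂d).toReal + ε ^ 2 / τ := by
  have hd : IsProbabilityMeasure d := hdd ▸ isProbabilityMeasure_bind_occupancy h0 h1 _ ρ
  obtain ⟨hint, hfin, hJ, hJeq⟩ := lintegral_klDiv_eq (π := π) hu d hK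
  have hpd := performance_difference (ρ := ρ) h0 h1 hτ.le hu πs
  rw [← hdd] at hpd
  have hq := isBdd_qLin hm hφ θ
  have hq' := isBdd_qLin hm hφ θ'
  have hh := isBdd_qLin hm hφ (θ - θ')
  have hmean := (hq.add (hu.1.const_mul τ)).integral_prod π.kernel
  -- Pinsker's inequality state by state, for the critic error rescaled by `2 / τ`.
  have hpin : ∫ s, (∫ a, qLin φ (θ - θ') (s, a) ∂(πs.kernel s)
      - ∫ a, qLin φ (θ - θ') (s, a) ∂(π.kernel s)) ∂d
      ≤ ∫ s, (τ / 2 * (klDiv (πs.kernel s) (π.kernel s)).toReal + ε ^ 2 / τ) ∂d := by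
    refine integral_mono_ae
      (((hh.integral_prod πs.kernel).sub (hh.integral_prod π.kernel)).integrable d)
      ((hint.const_mul _).add (integrable_const _)) ?_
    filter_upwards [ae_lt_top (measurable_klDiv_kernel πs.kernel π.kernel) hfin] with s hs
    have h2 := integral_sub_le_klDiv_add (ν := π.kernel s) (κ := πs.kernel s)
      (f := fun a => 2 / τ * qLin φ (θ - θ') (s, a)) (H := 2 / τ * ε)
      ((hh.1.comp measurable_prodMk_left).const_mul _) (fun a => by
        rw [abs_mul, abs_of_pos (by positivity)]
        exact mul_le_mul_of_nonneg_left ((abs_qLin_le hφ _ _).trans hε) (by positivity)) hs.ne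
    rw [integral_const_mul, integral_const_mul, ← mul_sub] at h2
    have h3 := mul_le_mul_of_nonneg_left h2 (by positivity : 0 ≤ τ / 2)
    have h4 : τ / 2 * ((klDiv (πs.kernel s) (π.kernel s)).toReal + (2 / τ * ε) ^ 2 / 2)
        = τ / 2 * (klDiv (πs.kernel s) (π.kernel s)).toReal + ε ^ 2 / τ := by
      field_simp
    rw [h4, ← mul_assoc, div_mul_div_cancel₀ (by norm_num : (2 : ℝ) ≠ 0), div_self hτ.ne',
      one_mul] at h3
    exact h3
  rw [integral_add (hint.const_mul _) (integrable_const _), integral_const_mul, hJ,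
    integral_const, probReal_univ, one_smul,
    integral_sub ((hh.integral_prod πs.kernel).integrable d)
      ((hh.integral_prod π.kernel).integrable d), ← integral_jointLaw d πs hh] at hpin
  have e1 : ∫ x, qLin φ (θ - θ') x ∂(jointLaw d πs)
      = ∫ x, qLin φ θ x ∂(jointLaw d πs) - ∫ x, qFun M γ τ π x ∂(jointLaw d πs) := by
    simp only [qLin_sub, hθ']
    exact integral_sub (hq.integrable _) (hq'.integrable _)
  have e2 : ∫ s, ∫ a, (qLin φ θ (s, a) + τ * u (s, a)) ∂(π.kernel s) ∂d
      = ∫ s, ∫ a, qLin φ (θ - θ') (s, a) ∂(π.kernel s) ∂d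
        + ∫ s, regValue M γ τ π u s ∂d := by
    rw [← integral_add ((hh.integral_prod π.kernel).integrable d)
      ((isBdd_regValue h0 h1 hu).integrable d)]
    refine integral_congr_ae (ae_of_all _ fun s => ?_)
    simp only [regValue_eq_integral_qFun h0 h1 hτ.le hu, hθ', qLin_sub]
    have hqs := (hq.comp (measurable_prodMk_left (x := s))).integrable (π.kernel s)
    have hqs' := (hq'.comp (measurable_prodMk_left (x := s))).integrable (π.kernel s)
    rw [integral_sub hqs hqs',
      integral_add hqs (((hu.section_bdd s).const_mul τ).integrable _), integral_const_mul]
    ring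
  have e3 : ∫ x, approxAdvantage τ φ θ π u x.1 x.2 ∂(jointLaw d πs)
      = ∫ x, qLin φ θ x ∂(jointLaw d πs) + τ * ∫ x, u x ∂(jointLaw d πs)
        - ∫ s, ∫ a, (qLin φ θ (s, a) + τ * u (s, a)) ∂(π.kernel s) ∂d := by
    have e4 : ∫ x : S × A, ∫ a, (qLin φ θ (x.1, a) + τ * u (x.1, a)) ∂(π.kernel x.1)
        ∂(jointLaw d πs)
        = ∫ s, ∫ a, (qLin φ θ (s, a) + τ * u (s, a)) ∂(π.kernel s) ∂d := by
      rw [integral_jointLaw d πs (hmean.comp measurable_fst)]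
      simp
    rw [← e4, ← integral_const_mul, ← integral_add (hq.integrable _)
      ((hu.1.const_mul τ).integrable _), ← integral_sub
      ((hq.add (hu.1.const_mul τ)).integrable _) ((hmean.comp measurable_fst).integrable _)]
    rfl
  rw [e3, e2]
  rw [e1] at hpin
  rw [hJeq] at hpin ⊢
  linarith

/-! ### Time derivative of the relative entropy -/

namespace FlowHyp

variable {β : Measure (S × A)} {η : ℝ → ℝ} {π : ℝ → Policy S A}
  {θ : ℝ → EuclideanSpace ℝ (Fin N)} {u : ℝ → S × A → ℝ} {C U R c W : ℝ}

theorem ae_init_jointLaw [MeasurableSpace.CountableOrCountablyGenerated S A]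
    (h : FlowHyp M γ τ φ β η π θ u C U) {d : Measure S} (hK : ∫⁻ s, klRef M πs s ∂d ≠ ⊤) :
    ∀ᵐ x ∂(jointLaw d πs), |u 0 x| ≤ U := by
  have hm := (h.logDensity 0 le_rfl).1.1
  refine ae_jointLaw d πs (measurableSet_le hm.abs measurable_const) ?_
  filter_upwards [ae_lt_top (measurable_klRef M πs) hK] with s hs
  exact (klDiv_ne_top_iff.1 hs.ne).1.ae_le (h.init s)

theorem hasDerivAt_integral_u [MeasurableSpace.CountableOrCountablyGenerated S A]
    (h : FlowHyp M γ τ φ β η π θ u C U) (hR : 0 < R) (hc : 0 < c)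
    (hW : W = 2 * U + 2 * R / c) (hθ : ∀ t, 0 ≤ t → ‖θ t‖ ≤ R * Real.exp (c * t))
    {d : Measure S} [IsProbabilityMeasure d] (hK : ∫⁻ s, klRef M πs s ∂d ≠ ⊤)
    {t : ℝ} (ht : 0 < t) :
    HasDerivAt (fun r => ∫ x, u r x ∂(jointLaw d πs))
      (-∫ x, approxAdvantage τ φ (θ t) (π t) (u t) x.1 x.2 ∂(jointLaw d πs)) t := by
  have hW0 : 0 ≤ W := by rw [hW]; have := h.U_nonneg; positivity
  have hA := isBdd_approxAdvantage (τ := τ) (θ := θ t) h.φ_meas h.φ_le (h.logDensity t ht.le)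
  rw [← integral_neg]
  refine (hasDerivAt_integral_of_dominated_loc_of_deriv_le (s := Ioo 0 (t + 1))
    (F' := fun r x => -approxAdvantage τ φ (θ r) (π r) (u r) x.1 x.2)
    (bound := fun _ => (2 * R + 2 * W) * Real.exp (c * (t + 1)))
    (Ioo_mem_nhds ht (by linarith)) ?_ ((h.logDensity t ht.le).1.integrable _)
    hA.1.neg.aestronglyMeasurable ?_ (integrable_const _) ?_).2
  · filter_upwards [lt_mem_nhds ht] with r hr
    exact (h.logDensity r hr.le).1.1.aestronglyMeasurable
  · filter_upwards [h.ae_init_jointLaw hK] with x hx r hr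
    rw [norm_neg]
    refine (h.abs_advantage_le hR hc hW hθ (s := x.1) (a := x.2) hx hr.1.le).trans ?_
    exact mul_le_mul_of_nonneg_left (Real.exp_le_exp.2
      (mul_le_mul_of_nonneg_left hr.2.le hc.le)) (by positivity)
  · refine ae_of_all _ fun x r hr => ?_
    exact (h.deriv_u hr.1.le x.1 x.2).hasDerivAt (Ici_mem_nhds hr.1)

theorem continuousOn_integral_u [MeasurableSpace.CountableOrCountablyGenerated S A]
    (h : FlowHyp M γ τ φ β η π θ u C U) (hR : 0 < R) (hc : 0 < c)
    (hW : W = 2 * U + 2 * R / c) (hθ : ∀ t, 0 ≤ t → ‖θ t‖ ≤ R * Real.exp (c * t))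
    {d : Measure S} [IsProbabilityMeasure d] (hK : ∫⁻ s, klRef M πs s ∂d ≠ ⊤) (T : ℝ) :
    ContinuousOn (fun r => ∫ x, u r x ∂(jointLaw d πs)) (Icc 0 T) := by
  have hW0 : 0 ≤ W := by rw [hW]; have := h.U_nonneg; positivity
  refine continuousOn_of_dist_le (K := (2 * R + 2 * W) * Real.exp (c * T)) (by positivity)
    fun t ht z hz htz => ?_
  rw [Real.dist_eq, ← integral_sub ((h.logDensity z hz.1).1.integrable _)
    ((h.logDensity t ht.1).1.integrable _)]
  refine abs_integral_le_of_ae ?_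
  filter_upwards [h.ae_init_jointLaw hK] with x hx
  refine (h.abs_u_sub_le hR hc hW hθ (s := x.1) (a := x.2) hx ht.1 htz).trans ?_
  refine mul_le_mul_of_nonneg_right (mul_le_mul_of_nonneg_left (Real.exp_le_exp.2
    (mul_le_mul_of_nonneg_left hz.2 hc.le)) (by positivity)) (sub_nonneg.2 htz)

theorem continuousOn_integral_regValue [MeasurableSpace.CountableOrCountablyGenerated S A]
    [IsProbabilityMeasure ρ]
    (h : FlowHyp M γ τ φ β η π θ u C U) (hR : 0 < R) (hc : 0 < c)
    (hW : W = 2 * U + 2 * R / c) (hθ : ∀ t, 0 ≤ t → ‖θ t‖ ≤ R * Real.exp (c * t)) (T : ℝ) :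
    ContinuousOn (fun r => ∫ s, regValue M γ τ (π r) (u r) s ∂ρ) (Icc 0 T) := by
  refine continuousOn_of_dist_le
    (K := |lipRate (1 - γ)⁻¹ C R W| * Real.exp (2 * c * T)) (by positivity)
    fun t ht z hz htz => ?_
  rw [Real.dist_eq, ← integral_sub
    ((isBdd_regValue h.γ_nonneg h.γ_lt (h.logDensity z hz.1)).integrable _)
    ((isBdd_regValue h.γ_nonneg h.γ_lt (h.logDensity t ht.1)).integrable _)]
  refine abs_integral_le_of_ae (ae_of_all _ fun s => ?_)
  refine (h.abs_regValue_sub_le hR hc hW hθ le_rfl ht.1 htz s).trans ?_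
  exact mul_le_mul_of_nonneg_right (mul_le_mul (le_abs_self _) (Real.exp_le_exp.2
    (mul_le_mul_of_nonneg_left hz.2 (by positivity))) (Real.exp_pos _).le (abs_nonneg _))
    (sub_nonneg.2 htz)

/-- Grönwall's argument for the relative entropy to `πs`, with the weight `e^{τt/2}`: if the value
along the flow stays above `m` on `[0, T]`, then `m` cannot exceed the value of `πs` by much. -/
theorem gap_le [MeasurableSpace.CountableOrCountablyGenerated S A] [IsProbabilityMeasure ρ]
    (h : FlowHyp M γ τ φ β η π θ u C U) (hR : 0 < R) (hc : 0 < c)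
    (hW : W = 2 * U + 2 * R / c) (hθ : ∀ t, 0 ≤ t → ‖θ t‖ ≤ R * Real.exp (c * t))
    {F : ℝ → EuclideanSpace ℝ (Fin N)}
    (hF : ∀ t, 0 ≤ t → ∀ x, qFun M γ τ (π t) x = qLin φ (F t) x)
    {D : ℝ} (hD : ∀ t, 0 ≤ t → ‖θ t - F t‖ ≤ D * Real.exp (-(τ / 2) * t))
    {d : Measure S} (hdd : d = stateOccupancy M γ πs ρ) (hK : ∫⁻ s, klRef M πs s ∂d ≠ ⊤)
    {v m T : ℝ} (hv : v = (1 - γ)⁻¹ * (∫ x, M.c x ∂(jointLaw d πs)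
      + τ * (∫⁻ s, klRef M πs s ∂d).toReal))
    (hT : 0 ≤ T) (hm : ∀ t ∈ Icc 0 T, m ≤ ∫ s, regValue M γ τ (π t) (u t) s ∂ρ) :
    (1 - γ) * (m - v) * (2 / τ) * (Real.exp (τ / 2 * T) - 1)
      ≤ (∫⁻ s, klDiv (πs.kernel s) ((π 0).kernel s) ∂d).toReal + 2 * D ^ 2 / τ ^ 2 := by
  have hd : IsProbabilityMeasure d :=
    hdd ▸ isProbabilityMeasure_bind_occupancy h.γ_nonneg h.γ_lt _ ρ
  have hτ := h.τ_pos
  have hγ : 0 < 1 - γ := by linarith [h.γ_lt]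
  set K := (∫⁻ s, klRef M πs s ∂d).toReal with hKdef
  set J : ℝ → ℝ := fun t => K - ∫ x, u t x ∂(jointLaw d πs) with hJdef
  have hJ : ∀ t, 0 ≤ t → (∫⁻ s, klDiv (πs.kernel s) ((π t).kernel s) ∂d).toReal = J t :=
    fun t ht => (lintegral_klDiv_eq (h.logDensity t ht) d hK).2.2.2
  have hJ0 : ∀ t, 0 ≤ t → 0 ≤ J t := fun t ht => by
    rw [← hJ t ht]; exact ENNReal.toReal_nonneg
  set Φ : ℝ → ℝ := fun t => Real.exp (τ / 2 * t) * J t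
    + (1 - γ) * (m - v) * (2 / τ) * Real.exp (τ / 2 * t)
    + 2 * D ^ 2 / τ ^ 2 * Real.exp (-(τ / 2) * t) with hΦ
  have hexp : ∀ (k t : ℝ), HasDerivAt (fun r => Real.exp (k * r)) (Real.exp (k * t) * k) t :=
    fun k t => by simpa using ((hasDerivAt_id t).const_mul k).exp
  have hderiv : ∀ t, 0 < t → HasDerivAt Φ
      (Real.exp (τ / 2 * t) * (τ / 2) * J t + Real.exp (τ / 2 * t)
        * (∫ x, approxAdvantage τ φ (θ t) (π t) (u t) x.1 x.2 ∂(jointLaw d πs))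
        + (1 - γ) * (m - v) * (2 / τ) * (Real.exp (τ / 2 * t) * (τ / 2))
        + 2 * D ^ 2 / τ ^ 2 * (Real.exp (-(τ / 2) * t) * (-(τ / 2)))) t := fun t ht => by
    have h1 := (h.hasDerivAt_integral_u hR hc hW hθ hK ht).const_sub K
    rw [neg_neg] at h1
    exact (((hexp _ t).mul h1).add ((hexp _ t).const_mul _)).add ((hexp _ t).const_mul _)
  have hanti : AntitoneOn Φ (Icc 0 T) := by
    refine antitoneOn_of_deriv_nonpos (convex_Icc 0 T) ?_ ?_ ?_
    · have h1 := h.continuousOn_integral_u hR hc hW hθ hK T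
      fun_prop
    · rw [interior_Icc]
      exact fun t ht => (hderiv t ht.1).differentiableAt.differentiableWithinAt
    · rw [interior_Icc]
      intro t ht
      rw [(hderiv t ht.1).deriv]
      have h1 := integral_approxAdvantage_le h.φ_meas h.φ_le h.γ_nonneg h.γ_lt hτ
        (h.logDensity t ht.1.le) (hF t ht.1.le) (hD t ht.1.le) hdd hK
      rw [hJ t ht.1.le] at h1
      have h2 := mul_le_mul_of_nonneg_left (hm t ⟨ht.1.le, ht.2.le⟩) hγ.le
      have h3 : ∫ x, M.c x ∂(jointLaw d πs) + τ * K = (1 - γ) * v := by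
        rw [hv]; field_simp
      set I := ∫ x, approxAdvantage τ φ (θ t) (π t) (u t) x.1 x.2 ∂(jointLaw d πs)
      have h4 : I ≤ -((1 - γ) * (m - v)) - τ / 2 * J t
          + (D * Real.exp (-(τ / 2) * t)) ^ 2 / τ := by linarith
      have h5 : Real.exp (τ / 2 * t) * Real.exp (-(τ / 2) * t) = 1 := by
        rw [← Real.exp_add, ← Real.exp_zero]; ring_nf
      have h6 := mul_le_mul_of_nonneg_left h4 (Real.exp_pos (τ / 2 * t)).le
      set X := Real.exp (τ / 2 * t)
      set Y := Real.exp (-(τ / 2) * t)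
      have h7 : X * ((D * Y) ^ 2 / τ) = D ^ 2 / τ * Y := by
        calc X * ((D * Y) ^ 2 / τ) = (X * Y) * (D ^ 2 / τ * Y) := by ring
          _ = _ := by rw [h5, one_mul]
      have h8 : (1 - γ) * (m - v) * (2 / τ) * (X * (τ / 2)) = X * ((1 - γ) * (m - v)) := by
        field_simp
      have h9 : 2 * D ^ 2 / τ ^ 2 * (Y * (-(τ / 2))) = -(D ^ 2 / τ * Y) := by
        field_simp
      rw [h8, h9]
      rw [mul_add, mul_sub, h7] at h6
      linarith
  have hfin := hanti (left_mem_Icc.2 hT) (right_mem_Icc.2 hT) hT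
  simp only [hΦ, mul_zero, Real.exp_zero, one_mul, mul_one] at hfin
  rw [hJ 0 le_rfl]
  have h1 : 0 ≤ Real.exp (τ / 2 * T) * J T := mul_nonneg (Real.exp_pos _).le (hJ0 T hT)
  have h2 : 0 ≤ 2 * D ^ 2 / τ ^ 2 * Real.exp (-(τ / 2) * T) := by positivity
  linarith

end FlowHyp

/-! ### The convergence rate -/

/-- The logarithmic density of a Gibbs policy is bounded by twice the bound of any exponent
generating it, almost everywhere. -/
theorem ae_abs_logDensity_le {μ : Measure A} [IsProbabilityMeasure μ] {π : Policy S A}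
    {f u : S × A → ℝ} (hf : IsBddMeasurable f) {B : ℝ} (hB : ∀ x, |f x| ≤ B)
    (hπ : ∀ s, π.kernel s = μ.tilted fun a => f (s, a)) (hu : IsLogDensity μ π u) (s : S) :
    ∀ᵐ a ∂μ, |u (s, a)| ≤ 2 * B := by
  have hfs : IsBddMeasurable fun a => f (s, a) := hf.comp measurable_prodMk_left
  have hus : IsBddMeasurable fun a => u (s, a) := hu.1.comp measurable_prodMk_left
  have h1 := log_rnDeriv_tilted_left_self (hfs.exp.integrable μ)
  have h2 := log_rnDeriv_tilted_left_self (hus.exp.integrable μ)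
  rw [← withDensity_exp_eq_tilted hus (hu.2 s), integral_exp_eq_one hus (hu.2 s), hπ s] at h2
  have hZ : |Real.log (∫ a, Real.exp (f (s, a)) ∂μ)| ≤ B := by
    have hlo : Real.exp (-B) ≤ ∫ a, Real.exp (f (s, a)) ∂μ := by
      have := integral_mono (μ := μ) (integrable_const (Real.exp (-B))) (hfs.exp.integrable μ)
        fun a => Real.exp_le_exp.2 (abs_le.1 (hB (s, a))).1
      simpa using this
    have hup : ∫ a, Real.exp (f (s, a)) ∂μ ≤ Real.exp B := by
      have := integral_mono (μ := μ) (hfs.exp.integrable μ) (integrable_const (Real.exp B))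
        fun a => Real.exp_le_exp.2 (abs_le.1 (hB (s, a))).2
      simpa using this
    have hpos := (Real.exp_pos _).trans_le hlo
    exact abs_le.2 ⟨(Real.le_log_iff_exp_le hpos).2 hlo, (Real.log_le_iff_le_exp hpos).2 hup⟩
  filter_upwards [h1, h2] with a ha1 ha2
  rw [ha1, Real.log_one, sub_zero] at ha2
  rw [← ha2]
  refine (abs_sub _ _).trans ?_
  linarith [hB (s, a)]

end Actor

end ActorCritic

open ActorCritic in
theorem theorem5 {S A : Type*}
    [TopologicalSpace S] [PolishSpace S] [MeasurableSpace S] [BorelSpace S]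
    [TopologicalSpace A] [PolishSpace A] [MeasurableSpace A] [BorelSpace A]
    (M : MDP S A) (τ : ℝ) (hτ₀ : 0 < τ) (hτ₁ : τ < 1)
    {N : ℕ} (φ : S × A → EuclideanSpace ℝ (Fin N)) (hφ_meas : Measurable φ)
    (hφ : ∀ x, ‖φ x‖ ≤ 1)
    (β : Measure (S × A)) [IsProbabilityMeasure β] (hβ : 0 < lambdaBeta φ β)
    (ρ : Measure S) [IsProbabilityMeasure ρ]
    (π₀ : Policy S A) (hπ₀ : π₀.Admissible M.μ) (θ₀ : EuclideanSpace ℝ (Fin N))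
    (η₀ : ℝ) :
    ∃ k₁ : ℝ, 0 < k₁ ∧ ∃ k₂ : ℝ, 0 < k₂ ∧
      ∀ γ : ℝ, 0 < γ → γ < 1 → Realisable M γ τ φ → 1 / bigGamma γ φ β < η₀ →
      ∀ (π : ℝ → Policy S A) (θ : ℝ → EuclideanSpace ℝ (Fin N)),
        IsFlow M γ τ φ β (fun t => η₀ * Real.exp (k₁ * t)) π₀ θ₀ π θ →
      ∀ πs : Policy S A, IsOptimal M γ τ ρ πs →
        (∫⁻ s, InformationTheory.klDiv (πs.kernel s) (π₀.kernel s)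
            ∂(stateOccupancy M γ πs ρ)) ≠ ⊤ ∧
        ∀ t : ℝ, 0 < t →
          ∃ m v : ℝ,
            IsLeast ((fun r => valueAt M γ τ (π r) ρ) '' Set.Icc 0 t) (m : EReal) ∧
            valueAt M γ τ πs ρ = (v : EReal) ∧
            m - v ≤ τ * Real.exp (-(τ / 2) * t)
                / (2 * (1 - γ) * (1 - Real.exp (-(τ / 2) * t)))
              * ((∫⁻ s, InformationTheory.klDiv (πs.kernel s) (π₀.kernel s)
                    ∂(stateOccupancy M γ πs ρ)).toReal + k₂ / (2 * τ)) := by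
  obtain ⟨C₀, hC₀⟩ := M.isBdd_c.2
  set C := |C₀| with hCdef
  have hC : ∀ x, |M.c x| ≤ C := fun x => (hC₀ x).trans (le_abs_self _)
  have hC0 : 0 ≤ C := abs_nonneg _
  obtain ⟨f, hf, hfπ⟩ := hπ₀
  obtain ⟨B₀, hB₀⟩ := hf.2
  set U := 2 * |B₀| with hUdef
  have hU0 : 0 ≤ U := by positivity
  -- All constants are independent of `γ`: the hypothesis `η₀ > 1 / Γ` bounds `1 / (1 - γ)` by `H`.
  -- The rate `c = 4 η₀` makes the part `2 R / c` of the log-density bound `W` at most `Γ R / 2`.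
  set c := 4 * |η₀| with hcdef
  set R := ‖θ₀‖ + 2 * |η₀| * (C + 2 * U) + 1 with hRdef
  set W := 2 * U + 2 * R / c with hWdef
  set H := |η₀| * lambdaBeta φ β with hHdef
  set L := (lambdaBeta φ β)⁻¹ * FlowHyp.lipRate H C R W with hLdef
  have hR : 0 < R := by positivity
  have hc0 : 0 ≤ c := by positivity
  have hW0 : 0 ≤ W := by positivity
  have hH0 : 0 ≤ H := by positivity
  have hL0 : 0 ≤ L := by
    rw [hLdef, FlowHyp.lipRate]; positivity
  set D := ‖θ₀‖ + (lambdaBeta φ β)⁻¹ * (H * (C + U)) + 2 * L + 1 with hDdef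
  have hD : 0 < D := by positivity
  refine ⟨2 * c + 1, by positivity, 4 * D ^ 2 / τ, by positivity, ?_⟩
  intro γ hγ0 hγ1 hreal hη π θ hflow πs hopt
  have hs1 : √γ < 1 := by rw [Real.sqrt_lt' one_pos]; simpa using hγ1
  have hs0 : 0 ≤ √γ := Real.sqrt_nonneg γ
  have hΓ : 0 < bigGamma γ φ β := mul_pos (mul_pos hβ (by linarith)) (by linarith)
  have hη0 : 0 < η₀ := (by positivity : 0 < 1 / bigGamma γ φ β).trans hη
  have habs : |η₀| = η₀ := abs_of_pos hη0
  rw [habs] at hcdef hRdef hHdef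
  have hc : 0 < c := by rw [hcdef]; positivity
  have hηΓ : 1 < η₀ * bigGamma γ φ β := by rwa [div_lt_iff₀ hΓ] at hη
  have hH : (1 - γ)⁻¹ ≤ H := by
    rw [inv_le_iff_one_le_mul₀ (by linarith), hHdef]
    have h1 : η₀ * bigGamma γ φ β = η₀ * lambdaBeta φ β * (1 - γ) * (1 - √γ) := by
      rw [bigGamma]; ring
    have h2 : 0 ≤ η₀ * lambdaBeta φ β * (1 - γ) :=
      mul_nonneg (by positivity) (by linarith)
    have h3 : η₀ * lambdaBeta φ β * (1 - γ) * (1 - √γ) ≤ η₀ * lambdaBeta φ β * (1 - γ) :=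
      mul_le_of_le_one_right h2 (by linarith)
    linarith
  obtain ⟨hπ0, hθ0, hdθ, u, hu, hdu⟩ := hflow
  have hinit : ∀ s, ∀ᵐ a ∂M.μ, |u 0 (s, a)| ≤ U := fun s => by
    have hu0 := hu 0 le_rfl
    rw [hπ0] at hu0
    exact ae_abs_logDensity_le hf (fun x => (hB₀ x).trans (le_abs_self _)) hfπ hu0 s
  have h : FlowHyp M γ τ φ β (fun t => η₀ * Real.exp ((2 * c + 1) * t)) π θ u C U :=
    ⟨hγ0.le, hγ1, hτ₀, hτ₁, hφ_meas, hφ, hC, hC0, hU0, fun t _ => by positivity, hdθ, hu, hdu,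
      hinit⟩
  have hWR : C + W ≤ bigGamma γ φ β * R := by
    have h1 : 2 * R / c = R / η₀ / 2 := by rw [hcdef]; field_simp; norm_num
    have h2 : R / η₀ ≤ bigGamma γ φ β * R := by
      rw [div_le_iff₀ hη0]
      nlinarith
    have h3 : C + 2 * U ≤ R / η₀ / 2 := by
      rw [div_div, le_div_iff₀ (by positivity), hRdef]
      linarith [norm_nonneg θ₀]
    rw [hWdef, h1]
    linarith
  have hθ : ∀ t, 0 ≤ t → ‖θ t‖ ≤ R * Real.exp (c * t) := fun t ht => by
    refine h.norm_θ_le hR hc hWdef ?_ hWR ht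
    rw [hθ0, hRdef]
    have : 0 ≤ 2 * η₀ * (C + 2 * U) := by positivity
    linarith
  have hex : ∀ t, ∃ w, 0 ≤ t → ∀ x, qFun M γ τ (π t) x = qLin φ w x := fun t => by
    by_cases ht : 0 ≤ t
    · obtain ⟨w, hw⟩ := hreal (π t) (h.admissible ht)
      exact ⟨w, fun _ => hw⟩
    · exact ⟨0, fun h0 => absurd h0 ht⟩
  choose F hF using hex
  have herr : ∀ t, 0 ≤ t → ‖θ t - F t‖ ≤ D * Real.exp (-(τ / 2) * t) := fun t ht => by
    refine h.critic_error_le (L := L) hc hF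
      (fun t z ht htz => h.norm_target_sub_le hR hc hWdef hθ hH hβ hF ht htz) hηΓ hD ?_ ?_ ht
    · have h1 := h.norm_target_zero_le hH hβ hF
      rw [hθ0]
      linarith [norm_sub_le θ₀ (F 0)]
    · have : 0 ≤ (lambdaBeta φ β)⁻¹ * (H * (C + U)) := by positivity
      linarith [norm_nonneg θ₀]
  have hK := hopt.lintegral_klRef_ne_top hγ0.le hγ1 hτ₀ (hu 0 le_rfl)
  have hd : IsProbabilityMeasure (stateOccupancy M γ πs ρ) :=
    isProbabilityMeasure_bind_occupancy hγ0.le hγ1 _ ρ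
  have hkl := lintegral_klDiv_eq (hu 0 le_rfl) (stateOccupancy M γ πs ρ) hK
  rw [hπ0] at hkl
  refine ⟨hkl.2.1, fun t ht => ?_⟩
  obtain ⟨r₀, hr₀, hmin⟩ := isCompact_Icc.exists_isMinOn (Set.nonempty_Icc.2 ht.le)
    (h.continuousOn_integral_regValue (ρ := ρ) hR hc hWdef hθ t)
  have hval : ∀ r ∈ Set.Icc 0 t, valueAt M γ τ (π r) ρ
      = ((∫ s, regValue M γ τ (π r) (u r) s ∂ρ : ℝ) : EReal) := fun r hr =>
    valueAt_eq hγ0.le hγ1 hτ₀.le (hu r hr.1) ρ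
  refine ⟨∫ s, regValue M γ τ (π r₀) (u r₀) s ∂ρ, _, ⟨⟨r₀, hr₀, hval r₀ hr₀⟩, ?_⟩,
    valueAt_eq_of_ne_top hγ0.le hγ1 hτ₀.le hK, ?_⟩
  · rintro _ ⟨r, hr, rfl⟩
    simp only [hval r hr]
    exact EReal.coe_le_coe_iff.2 (hmin hr)
  · have hgap := h.gap_le hR hc hWdef hθ hF herr rfl hK rfl ht.le (fun r hr => hmin hr)
    rw [hπ0] at hgap
    set J₀ := (∫⁻ s, InformationTheory.klDiv (πs.kernel s) (π₀.kernel s)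
      ∂(stateOccupancy M γ πs ρ)).toReal
    set Δ := ∫ s, regValue M γ τ (π r₀) (u r₀) s ∂ρ - _
    have hX : 1 < Real.exp (τ / 2 * t) := Real.one_lt_exp_iff.2 (by positivity)
    have hY : Real.exp (-(τ / 2) * t) = (Real.exp (τ / 2 * t))⁻¹ := by
      rw [← Real.exp_neg]; ring_nf
    have hγ : 0 < 1 - γ := by linarith
    rw [hY]
    set X := Real.exp (τ / 2 * t)
    have hX0 : 0 < X := by linarith
    have hX1 : 0 < X - 1 := by linarith
    have h1 : τ * X⁻¹ / (2 * (1 - γ) * (1 - X⁻¹)) = τ / (2 * (1 - γ) * (X - 1)) := by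
      field_simp
    have h2 : 4 * D ^ 2 / τ / (2 * τ) = 2 * D ^ 2 / τ ^ 2 := by field_simp; norm_num
    rw [h1, h2, div_mul_eq_mul_div, le_div_iff₀ (by positivity)]
    have h3 := mul_le_mul_of_nonneg_left hgap hτ₀.le
    have h4 : τ * ((1 - γ) * Δ * (2 / τ) * (X - 1)) = Δ * (2 * (1 - γ) * (X - 1)) := by
      field_simp
    rw [h4] at h3
    exact h3
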